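/- For $n,m\in\mathbb{N}_0$ let $V_{(n,m)}$ be the representation of $\mathrm{SU}(3)$ whose Young diagram has $n$ columns with one box and $m$ columns with two boxes, i.e. the subrepresentation of $\mathrm{Sym}^n(\mathbb{C}^3)\otimes\mathrm{Sym}^m(\Lambda^2\mathbb{C}^3)$ generated by the highest weight vector $e_1^n\otimes(e_1\wedge e_2)^m$, of weight $n\omega_1+m\omega_2$. For $p\in\mathbb{N}_0$ let $\mathrm{Sym}(p)$ be the $p$-th symmetric power of the fundamental representation $\mathbb{C}^3$ of $\mathrm{SU}(3)$, and $\mathrm{Hilb}(p)=\mathrm{Sym}(p)^{\otimes 3}$ with the diagonal action. Let $\mathcal{F}(3)=\mathrm{SU}(3)/\mathrm{S}(\mathrm{U}(1)^3)$ be the full flag manifold with its invariant probability measure, and let $\mathrm{SU}(3)$ act on $\mathrm{L}^2(\mathcal{F}(3))$ by $(gf)(x)=f(g^{-1}x)$. The multiplicity of an irreducible representation $V$ in a representation $W$ is $\dim\mathrm{Hom}_{\mathrm{SU}(3)}(V,W)$. Let $n,m,p\in\mathbb{N}_0$ with $n+2m=3(p+1)$. Then $V_{(n,m)}$ is irreducible;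 it does not occur in $\mathrm{Hilb}(p)$ (its multiplicity there is $0$); and it occurs with multiplicity exactly $\min(m,n)+1$ in $\mathrm{Hilb}(p+1)$, and also with multiplicity exactly $\min(m,n)+1$ in $\mathrm{L}^2(\mathcal{F}(3))$. -/

import Mathlib

open MeasureTheory TensorProduct

noncomputable section

namespace FlagThree

/-! ### The group `SU(3)` -/

/-- The group `SU(3)`. -/
abbrev SU3 : Type := Matrix.specialUnitaryGroup (Fin 3) ℂ

instance : IsTopologicalGroup SU3 where
  continuous_inv := by
    refine Continuous.subtype_mk ?_ _
    exact continuous_subtype_val.star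

instance : CompactSpace SU3 := by
  refine isCompact_iff_compactSpace.mp ?_
  have hc : IsCompact {A : Matrix (Fin 3) (Fin 3) ℂ | ∀ i j, A i j ∈ Metric.closedBall 0 1} := by
    have := isCompact_univ_pi fun _ : Fin 3 => isCompact_univ_pi fun _ : Fin 3 =>
      isCompact_closedBall (0 : ℂ) 1
    refine Eq.mp (congrArg _ ?_) this
    symm
    refine Set.ext (α := Fin 3 → Fin 3 → ℂ) fun A => ?_
    exact ⟨fun h i _ j _ => h i j, fun h i j => h i trivial j trivial⟩
  refine hc.of_isClosed_subset ?_ ?_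
  · have h1 : IsClosed {A : Matrix (Fin 3) (Fin 3) ℂ | A * star A = 1} :=
      isClosed_eq (by fun_prop) continuous_const
    have h2 : IsClosed {A : Matrix (Fin 3) (Fin 3) ℂ | A.det = 1} :=
      isClosed_eq (by fun_prop) continuous_const
    convert h1.inter h2 using 1
    ext A
    simp [Matrix.mem_specialUnitaryGroup_iff, Matrix.mem_unitaryGroup_iff]
  · intro A hA i j
    have hU : A ∈ Matrix.unitaryGroup (Fin 3) ℂ := (Matrix.mem_specialUnitaryGroup_iff.mp hA).1
    simpa using entry_norm_bound_of_unitary hU i j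

instance : MeasurableSpace SU3 := borel SU3

instance : BorelSpace SU3 := ⟨rfl⟩

/-! ### Symmetric powers -/

/-- The algebra endomorphism of `ℂ[X₀, X₁, X₂]` given by the linear substitution
`X j ↦ ∑ i, A i j • X i`.  Identifying `X j` with the basis vector `e j` of `ℂ³`, this is the map
that `A` induces on the symmetric algebra of `ℂ³`. -/
def linSubst (A : Matrix (Fin 3) (Fin 3) ℂ) :
    MvPolynomial (Fin 3) ℂ →ₐ[ℂ] MvPolynomial (Fin 3) ℂ :=
  MvPolynomial.aeval fun j => ∑ i, MvPolynomial.C (A i j) * MvPolynomial.X i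

theorem linSubst_mem (A : Matrix (Fin 3) (Fin 3) ℂ) (p : ℕ) {f : MvPolynomial (Fin 3) ℂ}
    (hf : f ∈ MvPolynomial.homogeneousSubmodule (Fin 3) ℂ p) :
    linSubst A f ∈ MvPolynomial.homogeneousSubmodule (Fin 3) ℂ p := by
  rw [MvPolynomial.mem_homogeneousSubmodule] at hf ⊢
  have h := hf.aeval (fun j => ∑ i, MvPolynomial.C (A i j) * MvPolynomial.X i) (n := 1)
    (fun j => MvPolynomial.IsHomogeneous.sum _ _ _ fun i _ => by
      simpa using (MvPolynomial.isHomogeneous_C (Fin 3) (A i j)).mul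
        (MvPolynomial.isHomogeneous_X ℂ i))
  simpa [linSubst] using h

theorem linSubst_one : linSubst 1 = AlgHom.id ℂ _ := by
  ext j : 1
  simp [linSubst, Matrix.one_apply]

theorem linSubst_mul (A B : Matrix (Fin 3) (Fin 3) ℂ) :
    linSubst (A * B) = (linSubst A).comp (linSubst B) := by
  ext j : 1
  simp only [linSubst, AlgHom.comp_apply, MvPolynomial.aeval_X, map_sum, map_mul,
    MvPolynomial.aeval_C, MvPolynomial.algebraMap_eq, Matrix.mul_apply, Finset.sum_mul,
    Finset.mul_sum]
  rw [Finset.sum_comm]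
  refine Finset.sum_congr rfl fun i _ => Finset.sum_congr rfl fun k _ => ?_
  ring

/-- The `p`-th symmetric power of a three-dimensional matrix representation `τ` of `SU(3)`, realized
on the homogeneous polynomials of degree `p` in the three basis vectors. -/
def symPower (τ : SU3 →* Matrix (Fin 3) (Fin 3) ℂ) (p : ℕ) :
    Representation ℂ SU3 (MvPolynomial.homogeneousSubmodule (Fin 3) ℂ p) where
  toFun g := (linSubst (τ g)).toLinearMap.restrict fun _ hf => linSubst_mem (τ g) p hf
  map_one' := by
    ext f : 2
    simp [linSubst_one, LinearMap.restrict_apply]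
  map_mul' g h := by
    ext f : 2
    change linSubst (τ (g * h)) f.1 = linSubst (τ g) (linSubst (τ h) f.1)
    rw [map_mul, linSubst_mul, AlgHom.comp_apply]

/-- The fundamental representation of `SU(3)` on `ℂ³`, as matrices. -/
def fund : SU3 →* Matrix (Fin 3) (Fin 3) ℂ := Submonoid.subtype _

/-- The exterior square `Λ²ℂ³` of the fundamental representation (one column of two boxes): in the
basis `e₁ ∧ e₂, e₂ ∧ e₀, e₀ ∧ e₁` (in this order) the matrix of `Λ² g` is the matrix of cofactors,
i.e. of signed `2 × 2` minors, of `g`. -/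
def extSquare : SU3 →* Matrix (Fin 3) (Fin 3) ℂ where
  toFun g := (g.1.adjugate).transpose
  map_one' := by simp
  map_mul' g h := by
    simp [Matrix.adjugate_mul_distrib, Matrix.transpose_mul]

/-- `Sym(p)`, the `p`-th symmetric power of the fundamental representation of `SU(3)`. -/
abbrev Sym (p : ℕ) : Representation ℂ SU3 (MvPolynomial.homogeneousSubmodule (Fin 3) ℂ p) :=
  symPower fund p

/-- `Hilb(p) = Sym(p) ⊗ Sym(p) ⊗ Sym(p)` with the diagonal action of `SU(3)`. -/
def Hilb (p : ℕ) :
    Representation ℂ SU3 (MvPolynomial.homogeneousSubmodule (Fin 3) ℂ p ⊗[ℂ]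
      (MvPolynomial.homogeneousSubmodule (Fin 3) ℂ p ⊗[ℂ]
        MvPolynomial.homogeneousSubmodule (Fin 3) ℂ p)) :=
  (Sym p).tprod ((Sym p).tprod (Sym p))

/-! ### Irreducible representations -/

/-- The subrepresentation generated by a vector. -/
def generated {G V : Type} [Monoid G] [AddCommMonoid V] [Module ℂ V] (ρ : Representation ℂ G V)
    (v : V) : Subrepresentation ρ where
  toSubmodule := Submodule.span ℂ (Set.range fun g => ρ g v)
  apply_mem_toSubmodule g w hw := by
    induction hw using Submodule.span_induction with
    | mem x hx =>
      obtain ⟨h, rfl⟩ := hx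
      refine Submodule.subset_span ⟨g * h, ?_⟩
      simp
    | zero => simp
    | add x y _ _ hx hy => simpa using add_mem hx hy
    | smul a x _ hx => simpa using Submodule.smul_mem _ a hx

/-- `(X i) ^ p` as an element of the space of homogeneous polynomials of degree `p`. -/
def powX (i : Fin 3) (p : ℕ) : MvPolynomial.homogeneousSubmodule (Fin 3) ℂ p :=
  ⟨MvPolynomial.X i ^ p, MvPolynomial.isHomogeneous_X_pow i p⟩

/-- The vector `e₀ ^ n ⊗ (e₀ ∧ e₁) ^ m` of `Sym^n(ℂ³) ⊗ Sym^m(Λ²ℂ³)`, where `n` and `m` are the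
numbers of columns with one and with two boxes.  It is a highest weight vector, of weight
`n ω₁ + m ω₂`. -/
def highestWeightVector (n m : ℕ) :
    MvPolynomial.homogeneousSubmodule (Fin 3) ℂ n ⊗[ℂ]
      MvPolynomial.homogeneousSubmodule (Fin 3) ℂ m :=
  powX 0 n ⊗ₜ[ℂ] powX 2 m

/-- The space of the irreducible representation of type `(n, m)`: the subrepresentation of
`Sym^n(ℂ³) ⊗ Sym^m(Λ²ℂ³)` generated by the highest weight vector of weight `n ω₁ + m ω₂`. -/
def irrepSub (n m : ℕ) : Subrepresentation ((symPower fund n).tprod (symPower extSquare m)) :=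
  generated _ (highestWeightVector n m)

instance (n m : ℕ) : AddCommGroup (irrepSub n m).toSubmodule :=
  Module.addCommMonoidToAddCommGroup ℂ

/-- The irreducible representation of `SU(3)` of type `(n, m)`, with highest weight
`n ω₁ + m ω₂`: its Young diagram has `n` columns with one box and `m` columns with two boxes. -/
def irrep (n m : ℕ) : Representation ℂ SU3 (irrepSub n m).toSubmodule :=
  (irrepSub n m).toRepresentation

/-! ### The flag manifold and its space of square integrable functions -/

/-- `S(U(1) × U(1) × U(1))`, the diagonal matrices in `SU(3)`. -/
def torus : Subgroup SU3 where
  carrier := {g | g.1.IsDiag}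
  one_mem' := Matrix.isDiag_one
  mul_mem' {g h} hg hh := by
    intro i j hij
    change (g.1 * h.1) i j = 0
    rw [Matrix.mul_apply]
    refine Finset.sum_eq_zero fun k _ => ?_
    by_cases hik : i = k
    · subst hik
      rw [hh hij, mul_zero]
    · rw [hg hik, zero_mul]
  inv_mem' {g} hg := by
    change (star g.1).IsDiag
    exact Matrix.IsDiag.conjTranspose hg

/-- The full flag manifold `F(3) = SU(3) / S(U(1) × U(1) × U(1))`.  The coset of `u` is the ordered
triple of orthogonal lines spanned by the columns of `u`. -/
abbrev F3 : Type := SU3 ⧸ torus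

instance : MeasurableConstSMul SU3 F3 where
  measurable_const_smul g := by
    rw [QuotientGroup.measurable_from_quotient]
    exact QuotientGroup.measurable_coe.comp (measurable_const_mul g)

/-- The `SU(3)`-invariant probability measure on `F(3)`, the image of the Haar measure of
`SU(3)`. -/
def flagMeasure : Measure F3 :=
  (Measure.haarMeasure (⊤ : TopologicalSpace.PositiveCompacts SU3)).map QuotientGroup.mk

instance : SMulInvariantMeasure SU3 F3 flagMeasure where
  measure_preimage_smul g s hs := by
    have hm : Measurable (QuotientGroup.mk : SU3 → F3) := QuotientGroup.measurable_coe
    rw [flagMeasure, Measure.map_apply hm (measurable_const_smul g hs), Measure.map_apply hm hs]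
    exact measure_preimage_mul _ g (QuotientGroup.mk ⁻¹' s)

/-- `L²(F(3))` with the action `(g f)(x) = f(g⁻¹ x)` of `SU(3)`. -/
def L2F3 : Representation ℂ SU3 (Lp ℂ 2 flagMeasure) where
  toFun g :=
    { toFun := fun f => DomMulAct.mk g⁻¹ • f
      map_add' := fun f₁ f₂ => smul_add _ f₁ f₂
      map_smul' := fun c f => smul_comm _ c f }
  map_one' := by
    ext1 f
    simp
  map_mul' g h := by
    ext1 f
    simp [mul_smul]

/-! ### Multiplicities -/

/-- The multiplicity of an irreducible representation `ρ` in a representation `σ`: the dimension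
of the space of intertwining maps `ρ → σ`.  It is a cardinal, so that no infinite dimension is
mistaken for zero. -/
def multiplicity {G V W : Type} [Monoid G] [AddCommMonoid V] [Module ℂ V]
    [AddCommMonoid W] [Module ℂ W] (ρ : Representation ℂ G V) (σ : Representation ℂ G W) : Cardinal :=
  Module.rank ℂ (Representation.IntertwiningMap ρ σ)

end FlagThree

end

/-!
The representation `V` of type `(n, m)` lies in `Sym^n(ℂ³) ⊗ Sym^m(Λ²ℂ³)`, the polynomials of
bidegree `(n, m)` in two vectors `x`, `y` of `ℂ³`, on which `SU(3)` acts through `g` and its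
conjugate. Let `T` be the diagonal torus. Everything rests on the space `I` of `T`-invariant linear
functionals on `V` and on the chain of inequalities

  `min(m, n) + 1 ≤ dim Hom(V, Hilb(p + 1)) ≤ dim I ≤ min(m, n) + 1`,

together with an isomorphism of `I` with `Hom(V, L²(F(3)))`.

* Irreducibility (`irrep_isIrreducible`): the weight space of the highest weight vector `v` is a
  line, so an invariant subspace of `V` with an element that has a nonzero component along `v`
  contains `v`, hence is `V`. If no element has such a component, then, since the translates of `v`
  are reproducing vectors for the definite Hermitian form on polynomials that makes monomials
  orthogonal, the subspace is orthogonal to all of `V`, hence zero.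
* Upper bound (`rank_torusInvariants_le`): averaging over the group generated by one sufficiently
  generic element of finite order of `T`, an invariant functional is determined by its restriction
  to the zero weight space. The elements of `V` are killed by `∑ i, ∂/∂xᵢ ∂/∂yᵢ`, and this
  recursion determines an element of weight zero from `min(m, n) + 1` of its coefficients.
* `Hom(V, Hilb(q)) → I` is injective (`evalOne_injective`): an element of `Hilb(q)` is a polynomial
  in the three columns of a matrix, of degree `q` in each, and evaluation at the identity matrix is
  `T`-invariant. An intertwiner is recovered from it because such a polynomial is determined by its
  values on `SU(3)` (`eq_zero_of_triEval_cols`). This density is proved by replacing, in families of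
  orthogonal frames depending polynomially on `z` and its conjugate, these two by independent
  variables, which turns rotations into shears and so reaches all invertible matrices.
* Lower bound (`le_rank_intertwiner_Hilb`): polarizing the polynomials of `V` along three vectors
  and their cross products yields intertwiners to `Hilb(p + 1)`, and `min(m, n) + 1` of them are
  told apart by their values on the highest weight vector.
* The highest weight of `V` is not a weight of `Hilb(p)` (`intertwiner_Hilb_eq_zero`).
* `I ≃ Hom(V, L²(F(3)))` (`toL2_injective`, `toL2_surjective`): an invariant functional `l` gives
  the functions `k T ↦ l (k⁻¹ w)`. Conversely the equivariance of an intertwiner holds, by Fubini,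
  at almost every point for almost all group elements at once, and evaluating at such a point gives
  the functional.
-/

noncomputable section

namespace FlagThree

/-! ### Coefficients on `Sym^n(ℂ³) ⊗ Sym^m(Λ²ℂ³)` -/

/-- The space of homogeneous polynomials of degree `n` in three variables. -/
abbrev HPoly (n : ℕ) : Submodule ℂ (MvPolynomial (Fin 3) ℂ) :=
  MvPolynomial.homogeneousSubmodule (Fin 3) ℂ n

/-- The ambient representation `Sym^n(ℂ³) ⊗ Sym^m(Λ²ℂ³)`. -/
abbrev ambient (n m : ℕ) : Representation ℂ SU3 (HPoly n ⊗[ℂ] HPoly m) :=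
  (symPower fund n).tprod (symPower extSquare m)

/-- The exponents of the monomials of degree `n` in three variables. -/
def exps (n : ℕ) : Finset (Fin 3 →₀ ℕ) := Finset.finsuppAntidiag Finset.univ n

theorem mem_exps {n : ℕ} {α : Fin 3 →₀ ℕ} : α ∈ exps n ↔ α 0 + α 1 + α 2 = n := by
  simp [exps, Finset.mem_finsuppAntidiag, Fin.sum_univ_three]

theorem mem_exps_iff_degree {n : ℕ} {α : Fin 3 →₀ ℕ} : α ∈ exps n ↔ α.degree = n := by
  rw [mem_exps, Finsupp.degree_eq_sum, Fin.sum_univ_three]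

/-- The value `∏ i, c i ^ α i` of the monomial with exponent `α` at `c`. -/
def monom {R : Type} [CommSemiring R] (α : Fin 3 →₀ ℕ) (c : Fin 3 → R) : R := ∏ i, c i ^ α i

/-- The functional taking the coefficient of the monomial `x ^ α ⊗ y ^ β`. -/
def coeffs (n m : ℕ) (α β : Fin 3 →₀ ℕ) : HPoly n ⊗[ℂ] HPoly m →ₗ[ℂ] ℂ :=
  LinearMap.mul' ℂ ℂ ∘ₗ TensorProduct.map (MvPolynomial.lcoeff ℂ α ∘ₗ (HPoly n).subtype)
    (MvPolynomial.lcoeff ℂ β ∘ₗ (HPoly m).subtype)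

@[simp]
theorem coeffs_tmul (n m : ℕ) (α β : Fin 3 →₀ ℕ) (f : HPoly n) (h : HPoly m) :
    coeffs n m α β (f ⊗ₜ h) = f.1.coeff α * h.1.coeff β := by
  simp [coeffs]

theorem coeff_eq_zero_of_notMem_exps {n : ℕ} (f : HPoly n) {α : Fin 3 →₀ ℕ} (hα : α ∉ exps n) :
    f.1.coeff α = 0 :=
  MvPolynomial.IsHomogeneous.coeff_eq_zero f.2 (by rwa [mem_exps_iff_degree] at hα)

theorem coeffs_eq_zero_left {n m : ℕ} {α : Fin 3 →₀ ℕ} (β : Fin 3 →₀ ℕ) (hα : α ∉ exps n) :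
    coeffs n m α β = 0 := by
  ext f h
  simp [coeff_eq_zero_of_notMem_exps f hα]

theorem coeffs_eq_zero_right {n m : ℕ} (α : Fin 3 →₀ ℕ) {β : Fin 3 →₀ ℕ} (hβ : β ∉ exps m) :
    coeffs n m α β = 0 := by
  ext f h
  simp [coeff_eq_zero_of_notMem_exps h hβ]

theorem eq_zero_of_coeffs {n m : ℕ} {w : HPoly n ⊗[ℂ] HPoly m}
    (hw : ∀ α ∈ exps n, ∀ β ∈ exps m, coeffs n m α β w = 0) : w = 0 := by
  have hw' : ∀ α β, coeffs n m α β w = 0 := fun α β => by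
    by_cases hα : α ∈ exps n
    · by_cases hβ : β ∈ exps m
      · exact hw α hα β hβ
      · simp [coeffs_eq_zero_right α hβ]
    · simp [coeffs_eq_zero_left β hα]
  let b := (MvPolynomial.basisMonomials (Fin 3) ℂ).tensorProduct
    (MvPolynomial.basisMonomials (Fin 3) ℂ)
  have hinj : Function.Injective (TensorProduct.map (HPoly n).subtype (HPoly m).subtype) :=
    TensorProduct.map_injective_of_flat_flat _ _ Subtype.val_injective Subtype.val_injective
  have key : ∀ (α β : Fin 3 →₀ ℕ) (x : HPoly n ⊗[ℂ] HPoly m),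
      b.repr (TensorProduct.map (HPoly n).subtype (HPoly m).subtype x) (α, β) =
        coeffs n m α β x := fun α β x => by
    induction x with
    | zero => simp
    | add x y hx hy => simp [hx, hy]
    | tmul f h =>
      rw [coeffs_tmul, TensorProduct.map_tmul, Module.Basis.tensorProduct_repr_tmul_apply]
      simp only [Submodule.subtype_apply, smul_eq_mul]
      rw [mul_comm]
      rfl
  apply hinj
  rw [map_zero]
  apply b.repr.injective
  ext ⟨α, β⟩
  rw [key, hw', map_zero, Finsupp.zero_apply]

/-- Evaluation of an element of `Sym^n(ℂ³) ⊗ Sym^m(Λ²ℂ³)`, seen as a polynomial in two sets of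
variables, at the point `(c, d)`. -/
def evalAt (n m : ℕ) (c d : Fin 3 → ℂ) : HPoly n ⊗[ℂ] HPoly m →ₗ[ℂ] ℂ :=
  LinearMap.mul' ℂ ℂ ∘ₗ TensorProduct.map ((MvPolynomial.aeval c).toLinearMap ∘ₗ (HPoly n).subtype)
    ((MvPolynomial.aeval d).toLinearMap ∘ₗ (HPoly m).subtype)

@[simp]
theorem evalAt_tmul (n m : ℕ) (c d : Fin 3 → ℂ) (f : HPoly n) (h : HPoly m) :
    evalAt n m c d (f ⊗ₜ h) = MvPolynomial.aeval c f.1 * MvPolynomial.aeval d h.1 := by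
  simp [evalAt]

theorem aeval_eq_sum_exps {R : Type} [CommRing R] [Algebra ℂ R] {n : ℕ} (f : HPoly n)
    (c : Fin 3 → R) :
    MvPolynomial.aeval c f.1 = ∑ α ∈ exps n, f.1.coeff α • monom α c := by
  rw [MvPolynomial.aeval_def, MvPolynomial.eval₂_eq']
  rw [Finset.sum_subset (s₂ := exps n) (fun α hα => ?_) fun α _ hα => ?_]
  · exact Finset.sum_congr rfl fun α _ => (Algebra.smul_def _ _).symm
  · by_contra h
    exact (MvPolynomial.mem_support_iff.mp hα) (coeff_eq_zero_of_notMem_exps f h)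
  · rw [MvPolynomial.notMem_support_iff.mp hα, map_zero, zero_mul]

theorem evalAt_eq_sum {n m : ℕ} (c d : Fin 3 → ℂ) (w : HPoly n ⊗[ℂ] HPoly m) :
    evalAt n m c d w =
      ∑ α ∈ exps n, ∑ β ∈ exps m, coeffs n m α β w * (monom α c * monom β d) := by
  induction w with
  | zero => simp
  | add x y hx hy => simp [hx, hy, add_mul, Finset.sum_add_distrib]
  | tmul f h =>
    rw [evalAt_tmul, aeval_eq_sum_exps f, aeval_eq_sum_exps h, Finset.sum_mul_sum]
    refine Finset.sum_congr rfl fun α _ => Finset.sum_congr rfl fun β _ => ?_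
    simp only [coeffs_tmul, smul_eq_mul]
    ring

theorem aeval_linSubst {R : Type} [CommRing R] [Algebra ℂ R] (A : Matrix (Fin 3) (Fin 3) ℂ)
    (c : Fin 3 → R) (f : MvPolynomial (Fin 3) ℂ) :
    MvPolynomial.aeval c (linSubst A f) =
      MvPolynomial.aeval (fun j => ∑ i, A i j • c i) f := by
  rw [← AlgHom.comp_apply]
  congr 1
  ext j
  simp [linSubst, Algebra.smul_def]

theorem evalAt_ambient {n m : ℕ} (c d : Fin 3 → ℂ) (g : SU3) (w : HPoly n ⊗[ℂ] HPoly m) :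
    evalAt n m c d (ambient n m g w) =
      evalAt n m (fun j => ∑ i, fund g i j • c i) (fun j => ∑ i, extSquare g i j • d i) w := by
  induction w with
  | zero => simp
  | add x y hx hy => simp only [map_add, hx, hy]
  | tmul f h =>
    rw [Representation.tprod_apply, TensorProduct.map_tmul, evalAt_tmul, evalAt_tmul]
    exact congrArg₂ _ (aeval_linSubst _ _ _) (aeval_linSubst _ _ _)

/-- The multinomial coefficient of the exponent `α`, as a complex number. -/
def mult (α : Fin 3 →₀ ℕ) : ℂ := (α.multinomial : ℂ)

theorem mult_ne_zero (α : Fin 3 →₀ ℕ) : mult α ≠ 0 := by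
  rw [mult, Nat.cast_ne_zero, ← Finsupp.multinomial_of_support_subset subset_rfl]
  exact (Nat.multinomial_pos _ _).ne'

theorem coeff_linear_pow (a : Fin 3 → ℂ) {n : ℕ} {α : Fin 3 →₀ ℕ} (hα : α ∈ exps n) :
    ((∑ i, MvPolynomial.C (a i) * MvPolynomial.X i : MvPolynomial (Fin 3) ℂ) ^ n).coeff α =
      mult α * monom α a := by
  have h : α.sum (fun _ k => k) = n := by
    rw [← mem_exps_iff_degree.mp hα]; rfl
  simp only [← MvPolynomial.smul_eq_C_mul]
  rw [MvPolynomial.coeff_linearCombination_X_pow_of_fintype, if_pos h, mult, monom,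
    Finsupp.prod_fintype _ _ (by simp)]

theorem linSubst_X_pow (A : Matrix (Fin 3) (Fin 3) ℂ) (j : Fin 3) (n : ℕ) :
    linSubst A (MvPolynomial.X j ^ n) = (∑ i, MvPolynomial.C (A i j) * MvPolynomial.X i) ^ n := by
  simp [linSubst]

/-- The first column of `g`. -/
def colFund (g : SU3) : Fin 3 → ℂ := fun i => fund g i 0

/-- The last column of `Λ² g`. -/
def colExt (g : SU3) : Fin 3 → ℂ := fun i => extSquare g i 2

theorem coeffs_ambient_highestWeightVector {n m : ℕ} (g : SU3) {α β : Fin 3 →₀ ℕ}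
    (hα : α ∈ exps n) (hβ : β ∈ exps m) :
    coeffs n m α β (ambient n m g (highestWeightVector n m)) =
      mult α * mult β * (monom α (colFund g) * monom β (colExt g)) := by
  rw [highestWeightVector, Representation.tprod_apply, TensorProduct.map_tmul, coeffs_tmul]
  change (linSubst (fund g) (MvPolynomial.X 0 ^ n)).coeff α *
    (linSubst (extSquare g) (MvPolynomial.X 2 ^ m)).coeff β = _
  rw [linSubst_X_pow, linSubst_X_pow, coeff_linear_pow _ hα, coeff_linear_pow _ hβ]
  unfold colFund colExt
  ring

theorem colFund_dotProduct_colExt (g : SU3) : ∑ i, colFund g i * colExt g i = 0 := by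
  have h := congrFun (congrFun (Matrix.adjugate_mul g.1) 2) 0
  rw [Matrix.mul_apply] at h
  simp only [Matrix.smul_apply, Matrix.one_apply, Fin.reduceEq, if_false, smul_zero] at h
  rw [← h]
  refine Finset.sum_congr rfl fun i _ => ?_
  rw [mul_comm]
  rfl

/-- The elements of the irreducible representation are harmonic, i.e. killed by
`∑ i, ∂/∂xᵢ ∂/∂yᵢ`.  In terms of coefficients divided by multinomials this is the relation below;
it holds since the first column of `g` is orthogonal to the last column of its cofactor matrix. -/
theorem sum_coeffs_div_mult_eq_zero {n m : ℕ} {w : HPoly n ⊗[ℂ] HPoly m}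
    (hw : w ∈ irrepSub n m) {α β : Fin 3 →₀ ℕ} (hα : α.degree + 1 = n) (hβ : β.degree + 1 = m) :
    ∑ i, coeffs n m (α + Finsupp.single i 1) (β + Finsupp.single i 1) w /
      (mult (α + Finsupp.single i 1) * mult (β + Finsupp.single i 1)) = 0 := by
  change w ∈ Submodule.span ℂ _ at hw
  induction hw using Submodule.span_induction with
  | zero => simp
  | add x y _ _ hx hy => simp [add_div, Finset.sum_add_distrib, hx, hy]
  | smul a x _ hx =>
    simp only [map_smul, smul_eq_mul, mul_div_assoc, ← Finset.mul_sum, hx, mul_zero]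
  | mem x hx =>
    obtain ⟨g, rfl⟩ := hx
    have hm : ∀ (γ : Fin 3 →₀ ℕ) (i : Fin 3) (c : Fin 3 → ℂ),
        monom (γ + Finsupp.single i 1) c = monom γ c * c i := fun γ i c => by
      simp only [monom, Finsupp.add_apply, pow_add, Finset.prod_mul_distrib]
      congr 1
      rw [Finset.prod_eq_single i (fun j _ hj => by simp [hj.symm]) (by simp)]
      simp
    have : ∀ i, coeffs n m (α + Finsupp.single i 1) (β + Finsupp.single i 1)
        (ambient n m g (highestWeightVector n m)) /
          (mult (α + Finsupp.single i 1) * mult (β + Finsupp.single i 1)) =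
        monom α (colFund g) * monom β (colExt g) * (colFund g i * colExt g i) := fun i => by
      rw [coeffs_ambient_highestWeightVector, hm, hm]
      · have := mult_ne_zero (α + Finsupp.single i 1)
        have := mult_ne_zero (β + Finsupp.single i 1)
        field_simp
      · rw [mem_exps_iff_degree, map_add, Finsupp.degree_single, hα]
      · rw [mem_exps_iff_degree, map_add, Finsupp.degree_single, hβ]
    rw [Finset.sum_congr rfl fun i _ => this i, ← Finset.mul_sum, colFund_dotProduct_colExt,
      mul_zero]

/-! ### Torus weights -/

/-- The exterior square of `g ∈ SU(3)` is the complex conjugate of `g`. -/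
theorem extSquare_eq (g : SU3) (i j : Fin 3) : extSquare g i j = star (fund g i j) := by
  have h1 : g.1 * g.1.adjugate = 1 := by
    rw [Matrix.mul_adjugate, (Matrix.mem_specialUnitaryGroup_iff.mp g.2).2, one_smul]
  have h2 : star g.1 * g.1 = 1 :=
    Matrix.mem_unitaryGroup_iff'.mp (Matrix.mem_specialUnitaryGroup_iff.mp g.2).1
  have h3 : star g.1 = g.1.adjugate := left_inv_eq_right_inv h2 h1
  change g.1.adjugate j i = _
  rw [← h3]
  rfl

theorem fund_inv (g : SU3) (i j : Fin 3) : fund g⁻¹ i j = star (fund g j i) := rfl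

/-- The primitive root of unity `exp (2πi / K²)`. -/
def rootUnity (K : ℕ) : ℂ := Complex.exp (2 * Real.pi * Complex.I / (K ^ 2 : ℕ))

theorem rootUnity_isPrimitiveRoot (K : ℕ) [NeZero K] : IsPrimitiveRoot (rootUnity K) (K ^ 2) :=
  Complex.isPrimitiveRoot_exp _ (NeZero.ne _)

theorem rootUnity_ne_zero (K : ℕ) : rootUnity K ≠ 0 := Complex.exp_ne_zero _

theorem star_rootUnity (K : ℕ) [NeZero K] : star (rootUnity K) = (rootUnity K)⁻¹ :=
  Complex.conj_rootsOfUnity (ζ := Units.mk0 _ (rootUnity_ne_zero K)) (n := K ^ 2) (by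
    rw [mem_rootsOfUnity]
    ext
    exact (rootUnity_isPrimitiveRoot K).pow_eq_one)

/-- The exponents of the entries of the diagonal matrix `torusElt K`. -/
def torusExponent (K : ℕ) : Fin 3 → ℤ := ![1, K, -1 - K]

/-- The diagonal element of `SU(3)` with entries `ζ, ζ ^ K, ζ ^ (-1 - K)`, where `ζ` is a primitive
root of unity of order `K ^ 2`.  Its eigenvalues separate the weights of size less than `K`. -/
def torusElt (K : ℕ) [NeZero K] : SU3 :=
  ⟨Matrix.diagonal fun i => rootUnity K ^ torusExponent K i, by
    have h0 := rootUnity_ne_zero K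
    rw [Matrix.mem_specialUnitaryGroup_iff, Matrix.mem_unitaryGroup_iff]
    constructor
    · rw [Matrix.star_eq_conjTranspose, Matrix.diagonal_conjTranspose, Matrix.diagonal_mul_diagonal,
        ← Matrix.diagonal_one]
      congr 1
      funext i
      rw [Pi.star_apply, star_zpow₀, star_rootUnity, inv_zpow, mul_inv_cancel₀ (zpow_ne_zero _ h0)]
    · rw [Matrix.det_diagonal, Fin.prod_univ_three, ← zpow_add₀ h0, ← zpow_add₀ h0]
      simp [torusExponent]⟩

theorem torusElt_mem_torus (K : ℕ) [NeZero K] : torusElt K ∈ torus :=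
  Matrix.isDiag_diagonal _

theorem linSubst_diagonal (s : Fin 3 → ℂ) (j : Fin 3) :
    linSubst (Matrix.diagonal s) (MvPolynomial.X j) = MvPolynomial.C (s j) * MvPolynomial.X j := by
  rw [linSubst, MvPolynomial.aeval_X, Finset.sum_eq_single j (fun i _ hi => by
    rw [Matrix.diagonal_apply_ne _ hi, map_zero, zero_mul]) (by simp), Matrix.diagonal_apply_eq]

theorem coeff_linSubst_diagonal (s : Fin 3 → ℂ) (α : Fin 3 →₀ ℕ) (f : MvPolynomial (Fin 3) ℂ) :
    (linSubst (Matrix.diagonal s) f).coeff α = monom α s * f.coeff α := by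
  induction f using MvPolynomial.induction_on' with
  | add p q hp hq => simp only [map_add, MvPolynomial.coeff_add, hp, hq, mul_add]
  | monomial γ a =>
    have : linSubst (Matrix.diagonal s) (MvPolynomial.monomial γ a) =
        MvPolynomial.monomial γ (monom γ s * a) := by
      rw [MvPolynomial.monomial_eq, MvPolynomial.monomial_eq, map_mul,
        Finsupp.prod_fintype _ _ (by simp), map_prod]
      simp only [map_pow, linSubst_diagonal, mul_pow, Finset.prod_mul_distrib]
      rw [map_mul, monom]
      simp only [map_prod, map_pow]
      rw [show linSubst (Matrix.diagonal s) (MvPolynomial.C a) = MvPolynomial.C a from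
        (linSubst _).commutes a]
      ring
    rw [this, MvPolynomial.coeff_monomial, MvPolynomial.coeff_monomial]
    split_ifs with h
    · rw [h]
    · rw [mul_zero]

/-- The exponent of the eigenvalue of `torusElt K` on `x ^ α`. -/
def torusWeight (K : ℕ) (α : Fin 3 →₀ ℕ) : ℤ := ∑ i, torusExponent K i * α i

theorem torusWeight_eq (K : ℕ) (α : Fin 3 →₀ ℕ) :
    torusWeight K α = α 0 + K * α 1 + (-1 - K) * α 2 := by
  simp [torusWeight, Fin.sum_univ_three, torusExponent]

theorem monom_torusElt (K : ℕ) (α : Fin 3 →₀ ℕ) :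
    monom α (fun i => rootUnity K ^ torusExponent K i) = rootUnity K ^ torusWeight K α := by
  have h0 := rootUnity_ne_zero K
  rw [monom, torusWeight, Fin.prod_univ_three, Fin.sum_univ_three, zpow_add₀ h0, zpow_add₀ h0]
  simp only [zpow_mul, zpow_natCast]

theorem monom_star (α : Fin 3 →₀ ℕ) (c : Fin 3 → ℂ) : monom α (star c) = star (monom α c) := by
  simp [monom]

theorem coeffs_torusElt {n m : ℕ} (K : ℕ) [NeZero K] (α β : Fin 3 →₀ ℕ)
    (w : HPoly n ⊗[ℂ] HPoly m) :
    coeffs n m α β (ambient n m (torusElt K) w) =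
      rootUnity K ^ (torusWeight K α - torusWeight K β) * coeffs n m α β w := by
  induction w with
  | zero => simp
  | add x y hx hy => simp only [map_add, hx, hy, mul_add]
  | tmul f h =>
    have h0 := rootUnity_ne_zero K
    rw [Representation.tprod_apply, TensorProduct.map_tmul, coeffs_tmul, coeffs_tmul]
    change (linSubst (fund (torusElt K)) f.1).coeff α *
      (linSubst (extSquare (torusElt K)) h.1).coeff β = _
    have h1 : fund (torusElt K) = Matrix.diagonal fun i => rootUnity K ^ torusExponent K i := rfl
    have h2 : extSquare (torusElt K) =
        Matrix.diagonal (star fun i => rootUnity K ^ torusExponent K i) := by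
      ext i j
      rw [extSquare_eq, h1, Matrix.diagonal_apply, Matrix.diagonal_apply]
      split_ifs <;> simp
    rw [h2, h1, coeff_linSubst_diagonal, coeff_linSubst_diagonal, monom_star, monom_torusElt,
      monom_torusElt, star_zpow₀, star_rootUnity, inv_zpow, zpow_sub₀ h0]
    ring

theorem coeffs_torusElt_pow {n m : ℕ} (K : ℕ) [NeZero K] (k : ℕ) (α β : Fin 3 →₀ ℕ)
    (w : HPoly n ⊗[ℂ] HPoly m) :
    coeffs n m α β (ambient n m (torusElt K ^ k) w) =
      (rootUnity K ^ (torusWeight K α - torusWeight K β)) ^ k * coeffs n m α β w := by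
  induction k with
  | zero => simp
  | succ k ih =>
    rw [pow_succ', map_mul, Module.End.mul_apply, coeffs_torusElt, ih]
    ring

/-- The projection on the eigenspace of `torusElt K` with eigenvalue `ζ ^ θ`, as an average over the
cyclic group generated by `torusElt K`. -/
def weightProj (n m K : ℕ) [NeZero K] (θ : ℤ) (w : HPoly n ⊗[ℂ] HPoly m) : HPoly n ⊗[ℂ] HPoly m :=
  ((K ^ 2 : ℕ) : ℂ)⁻¹ • ∑ k ∈ Finset.range (K ^ 2),
    (rootUnity K ^ (-θ)) ^ k • ambient n m (torusElt K ^ k) w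

theorem coeffs_weightProj {n m K : ℕ} [NeZero K] (θ : ℤ) (α β : Fin 3 →₀ ℕ)
    (w : HPoly n ⊗[ℂ] HPoly m) :
    coeffs n m α β (weightProj n m K θ w) =
      if ((K ^ 2 : ℕ) : ℤ) ∣ torusWeight K α - torusWeight K β - θ then coeffs n m α β w
      else 0 := by
  have h0 := rootUnity_ne_zero K
  have hK : ((K ^ 2 : ℕ) : ℂ) ≠ 0 := Nat.cast_ne_zero.mpr (NeZero.ne _)
  have hr := rootUnity_isPrimitiveRoot K
  set z : ℂ := rootUnity K ^ (torusWeight K α - torusWeight K β - θ) with hz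
  have hsum : coeffs n m α β (weightProj n m K θ w) =
      ((K ^ 2 : ℕ) : ℂ)⁻¹ * ((∑ k ∈ Finset.range (K ^ 2), z ^ k) * coeffs n m α β w) := by
    rw [weightProj, map_smul, map_sum, smul_eq_mul, Finset.sum_mul]
    congr 1
    refine Finset.sum_congr rfl fun k _ => ?_
    rw [map_smul, coeffs_torusElt_pow, smul_eq_mul, ← mul_assoc, ← mul_pow, ← zpow_add₀ h0, hz]
    congr 3
    ring
  rw [hsum]
  split_ifs with h
  · have : z = 1 := (hr.zpow_eq_one_iff_dvd _).mpr h
    simp only [this, one_pow, Finset.sum_const, Finset.card_range, nsmul_eq_mul, mul_one]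
    rw [← mul_assoc, inv_mul_cancel₀ hK, one_mul]
  · have h1 : z ≠ 1 := fun h1 => h ((hr.zpow_eq_one_iff_dvd _).mp h1)
    have h2 : z ^ (K ^ 2) = 1 := by
      rw [hz, ← zpow_natCast, ← zpow_mul, mul_comm, zpow_mul, zpow_natCast, hr.pow_eq_one, one_zpow]
    rw [geom_sum_eq h1, h2, sub_self, zero_div, zero_mul, mul_zero]

theorem weightProj_mem {n m K : ℕ} [NeZero K] (θ : ℤ) {W : Submodule ℂ (HPoly n ⊗[ℂ] HPoly m)}
    (hW : ∀ g, ∀ w ∈ W, ambient n m g w ∈ W) {w : HPoly n ⊗[ℂ] HPoly m} (hw : w ∈ W) :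
    weightProj n m K θ w ∈ W :=
  W.smul_mem _ (W.sum_mem fun _ _ => W.smul_mem _ (hW _ _ hw))

/-- Small integers are recovered from `a + K * b` modulo `K ^ 2`. -/
theorem eq_zero_of_sq_dvd_add_mul {K : ℕ} {a b : ℤ} (ha : |a| < K) (hb : |b| < K)
    (h : ((K ^ 2 : ℕ) : ℤ) ∣ a + K * b) : a = 0 ∧ b = 0 := by
  have hK : (K : ℤ) ≠ 0 := by have := abs_nonneg a; omega
  have h1 : (K : ℤ) ∣ a := by
    have : (K : ℤ) ∣ a + K * b := (Dvd.intro_left ((K : ℤ) ^ 1) (by push_cast; ring)).trans h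
    exact (dvd_add_left (dvd_mul_right _ _)).mp this
  have ha0 : a = 0 := Int.eq_zero_of_abs_lt_dvd h1 ha
  refine ⟨ha0, Int.eq_zero_of_abs_lt_dvd ?_ hb⟩
  rw [ha0, zero_add] at h
  push_cast at h
  rw [sq] at h
  exact Int.dvd_of_mul_dvd_mul_left hK h

/-! ### Irreducibility -/

theorem evalAt_single {n m : ℕ} (i j : Fin 3) (w : HPoly n ⊗[ℂ] HPoly m) :
    evalAt n m (Pi.single i 1) (Pi.single j 1) w =
      coeffs n m (Finsupp.single i n) (Finsupp.single j m) w := by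
  have key : ∀ (k : ℕ) (i : Fin 3) (α : Fin 3 →₀ ℕ), α ∈ exps k →
      monom α (Pi.single i (1 : ℂ)) = if α = Finsupp.single i k then 1 else 0 := by
    intro k i α hα
    split_ifs with h
    · subst h
      refine Finset.prod_eq_one fun j _ => ?_
      by_cases hj : j = i
      · subst hj; simp
      · simp [Ne.symm hj]
    · by_contra h'
      refine h ?_
      have h0 : ∀ j, j ≠ i → α j = 0 := fun j hj => by
        by_contra hα0
        exact h' (Finset.prod_eq_zero (Finset.mem_univ j) (by simp [hj, hα0]))
      have hs : α = Finsupp.single i (α i) := by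
        ext j
        by_cases hj : j = i
        · subst hj; simp
        · rw [h0 j hj, Finsupp.single_apply, if_neg (Ne.symm hj)]
      rw [mem_exps_iff_degree, hs, Finsupp.degree_single] at hα
      rw [hs, hα]
  have hmem : ∀ (k : ℕ) (i : Fin 3), Finsupp.single i k ∈ exps k := fun k i => by
    rw [mem_exps_iff_degree, Finsupp.degree_single]
  rw [evalAt_eq_sum, Finset.sum_eq_single (Finsupp.single i n),
    Finset.sum_eq_single (Finsupp.single j m)]
  · simp [key _ _ _ (hmem _ _)]
  · intro β hβ hne
    simp [key _ _ _ hβ, hne]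
  · exact fun h => absurd (hmem _ _) h
  · intro α hα hne
    exact Finset.sum_eq_zero fun β _ => by simp [key _ _ _ hα, hne]
  · exact fun h => absurd (hmem _ _) h

theorem coeffs_highestWeightVector (n m : ℕ) (α β : Fin 3 →₀ ℕ) :
    coeffs n m α β (highestWeightVector n m) =
      if α = Finsupp.single 0 n ∧ β = Finsupp.single 2 m then 1 else 0 := by
  rw [highestWeightVector, coeffs_tmul]
  simp only [powX, MvPolynomial.coeff_X_pow, eq_comm (a := α), eq_comm (a := β)]
  split_ifs <;> simp_all

/-- The weight space of the highest weight is one-dimensional; therefore a stable subspace that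
has an element with a nonzero component of this weight contains the highest weight vector. -/
theorem highestWeightVector_mem {n m : ℕ} {W : Submodule ℂ (HPoly n ⊗[ℂ] HPoly m)}
    (hW : ∀ g, ∀ w ∈ W, ambient n m g w ∈ W) {w : HPoly n ⊗[ℂ] HPoly m} (hw : w ∈ W)
    (h : coeffs n m (Finsupp.single 0 n) (Finsupp.single 2 m) w ≠ 0) :
    highestWeightVector n m ∈ W := by
  set c := coeffs n m (Finsupp.single 0 n) (Finsupp.single 2 m) w with hc
  -- All differences of exponents that occur below are less than `K` in absolute value.
  let K := 2 * (n + m) + 1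
  have hproj : weightProj n m K (n + m + K * m) w = c • highestWeightVector n m := by
    rw [← sub_eq_zero]
    refine eq_zero_of_coeffs fun α hα β hβ => ?_
    rw [map_sub, map_smul, coeffs_weightProj, coeffs_highestWeightVector]
    by_cases hαβ : α = Finsupp.single 0 n ∧ β = Finsupp.single 2 m
    · rw [if_pos, if_pos hαβ, hαβ.1, hαβ.2, smul_eq_mul, mul_one, sub_self]
      rw [hαβ.1, hαβ.2, torusWeight_eq, torusWeight_eq]
      simp only [ne_eq, Fin.reduceEq, not_false_eq_true, Finsupp.single_eq_same,
        Finsupp.single_eq_of_ne]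
      exact Dvd.intro 0 (by push_cast; ring)
    · rw [if_neg, if_neg hαβ, smul_zero, sub_self]
      intro hdvd
      apply hαβ
      rw [mem_exps] at hα hβ
      rw [torusWeight_eq, torusWeight_eq] at hdvd
      have := (eq_zero_of_sq_dvd_add_mul (K := K)
        (a := (α 0 - α 2 - β 0 + β 2 : ℤ) - n - m) (b := (α 1 - α 2 - β 1 + β 2 : ℤ) - m)
        (by rw [abs_lt]; omega) (by rw [abs_lt]; omega) (by convert hdvd using 1; ring)).1
      constructor
      · ext i; fin_cases i <;> simp <;> omega
      · ext i; fin_cases i <;> simp <;> omega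
  have := W.smul_mem c⁻¹ (weightProj_mem (K := K) (n + m + K * m) hW hw)
  rwa [hproj, smul_smul, inv_mul_cancel₀ h, one_smul] at this

/-- The highest weight vector reproduces the values of a polynomial for the Hermitian form that
makes the monomials orthogonal with squared norms the inverse multinomials; as this form is
definite, an element of the irreducible representation all of whose translates have no component
along the highest weight vector is zero. -/
theorem eq_zero_of_forall_coeffs_ambient {n m : ℕ} {w : HPoly n ⊗[ℂ] HPoly m}
    (hw : w ∈ irrepSub n m)
    (h : ∀ g, coeffs n m (Finsupp.single 0 n) (Finsupp.single 2 m) (ambient n m g w) = 0) :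
    w = 0 := by
  have hev : ∀ g : SU3, evalAt n m (star (colFund g)) (star (colExt g)) w = 0 := fun g => by
    rw [← h g⁻¹, ← evalAt_single, evalAt_ambient]
    congr 2
    · funext j
      rw [Finset.sum_eq_single 0 (by simp +contextual) (by simp)]
      simp [fund_inv, colFund]
    · funext j
      rw [Finset.sum_eq_single 2 (by simp +contextual) (by simp)]
      simp [fund_inv, colExt, extSquare_eq]
  change w ∈ Submodule.span ℂ (Set.range _) at hw
  obtain ⟨c, hc⟩ := (Finsupp.mem_span_range_iff_exists_finsupp).mp hw
  have hcoef : ∀ α ∈ exps n, ∀ β ∈ exps m, coeffs n m α β w = mult α * mult β *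
      c.sum fun g a => a * (monom α (colFund g) * monom β (colExt g)) := by
    intro α hα β hβ
    rw [← hc, Finsupp.sum, map_sum, Finsupp.sum, Finset.mul_sum]
    refine Finset.sum_congr rfl fun g _ => ?_
    rw [map_smul, smul_eq_mul]
    erw [coeffs_ambient_highestWeightVector g hα hβ]
    ring
  have hzero : ∑ α ∈ exps n, ∑ β ∈ exps m,
      coeffs n m α β w * star (coeffs n m α β w) / (mult α * mult β) = 0 := by
    have h1 : ∑ α ∈ exps n, ∑ β ∈ exps m,
        coeffs n m α β w * star (coeffs n m α β w) / (mult α * mult β) =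
        c.sum fun g a => star a * evalAt n m (star (colFund g)) (star (colExt g)) w := by
      simp only [Finsupp.sum, evalAt_eq_sum, Finset.mul_sum]
      rw [Finset.sum_comm (s := c.support)]
      refine Finset.sum_congr rfl fun α hα => ?_
      rw [Finset.sum_comm (s := c.support)]
      refine Finset.sum_congr rfl fun β hβ => ?_
      have hs : star (coeffs n m α β w) = mult α * mult β *
          ∑ g ∈ c.support,
            star (c g) * (monom α (star (colFund g)) * monom β (star (colExt g))) := by
        rw [hcoef α hα β hβ]
        simp [mult, Finsupp.sum, monom_star]
      rw [hs]
      have := mult_ne_zero α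
      have := mult_ne_zero β
      field_simp
      rw [Finset.mul_sum]
      exact Finset.sum_congr rfl fun g _ => by ring
    rw [h1]
    exact Finset.sum_eq_zero fun g _ => by simp [hev]
  have hre : ∑ α ∈ exps n, ∑ β ∈ exps m,
      Complex.normSq (coeffs n m α β w) / (α.multinomial * β.multinomial : ℝ) = 0 := by
    have : ((∑ α ∈ exps n, ∑ β ∈ exps m,
      Complex.normSq (coeffs n m α β w) / (α.multinomial * β.multinomial : ℝ) : ℝ) : ℂ) = 0 := by
      rw [← hzero]
      push_cast
      refine Finset.sum_congr rfl fun α _ => Finset.sum_congr rfl fun β _ => ?_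
      rw [← Complex.mul_conj]
      rfl
    exact_mod_cast this
  have hnn : ∀ α β : Fin 3 →₀ ℕ,
      0 ≤ Complex.normSq (coeffs n m α β w) / (α.multinomial * β.multinomial : ℝ) := fun α β =>
    div_nonneg (Complex.normSq_nonneg _) (by positivity)
  refine eq_zero_of_coeffs fun α hα β hβ => ?_
  have h1 := (Finset.sum_eq_zero_iff_of_nonneg fun α _ => Finset.sum_nonneg fun β _ => hnn α β).mp
    hre α hα
  have h2 := (Finset.sum_eq_zero_iff_of_nonneg fun β _ => hnn α β).mp h1 β hβ
  have h3 : (α.multinomial * β.multinomial : ℝ) ≠ 0 := by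
    have := mult_ne_zero α
    have := mult_ne_zero β
    simp only [mult, ne_eq, Nat.cast_eq_zero] at *
    simp [*]
  exact Complex.normSq_eq_zero.mp ((div_eq_zero_iff.mp h2).resolve_right h3)

theorem highestWeightVector_mem_irrepSub (n m : ℕ) : highestWeightVector n m ∈ irrepSub n m :=
  Submodule.subset_span ⟨1, by simp⟩

theorem highestWeightVector_ne_zero (n m : ℕ) : highestWeightVector n m ≠ 0 := fun h => by
  have := coeffs_highestWeightVector n m (Finsupp.single 0 n) (Finsupp.single 2 m)
  simp [h] at this

theorem irrep_isIrreducible (n m : ℕ) : (irrep n m).IsIrreducible where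
  exists_pair_ne := by
    refine ⟨⊥, ⊤, fun h => highestWeightVector_ne_zero n m ?_⟩
    have h1 : (⟨_, highestWeightVector_mem_irrepSub n m⟩ : (irrepSub n m).toSubmodule) ∈
        (⊤ : Subrepresentation (irrep n m)).toSubmodule := Submodule.mem_top
    rw [← h] at h1
    exact congrArg Subtype.val ((Submodule.mem_bot ℂ).mp h1)
  eq_bot_or_eq_top W := by
    let W' : Submodule ℂ (HPoly n ⊗[ℂ] HPoly m) :=
      W.toSubmodule.map (irrepSub n m).toSubmodule.subtype
    have hW' : ∀ g, ∀ w ∈ W', ambient n m g w ∈ W' := by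
      rintro g _ ⟨w, hw, rfl⟩
      exact ⟨irrep n m g w, W.apply_mem_toSubmodule g hw, rfl⟩
    by_cases hv : highestWeightVector n m ∈ W'
    · right
      obtain ⟨v, hv, hv'⟩ := hv
      apply Subrepresentation.toSubmodule_injective
      refine eq_top_iff.mpr fun w _ => ?_
      have hle : (irrepSub n m).toSubmodule ≤ W' := by
        refine Submodule.span_le.mpr ?_
        rintro _ ⟨g, rfl⟩
        exact hW' g _ ⟨v, hv, hv'⟩
      obtain ⟨w', hw', h⟩ := hle w.2
      rwa [← Subtype.ext (a1 := w') (a2 := w) h]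
    · left
      apply Subrepresentation.toSubmodule_injective
      refine eq_bot_iff.mpr fun w hw => ?_
      refine (Submodule.mem_bot ℂ).mpr (Subtype.ext ?_)
      refine eq_zero_of_forall_coeffs_ambient w.2 fun g => ?_
      by_contra hne
      exact hv (highestWeightVector_mem hW' (hW' g _ ⟨w, hw, rfl⟩) hne)

/-! ### Torus invariant functionals -/

/-- The torus invariant linear functionals on the irreducible representation of type `(n, m)`. -/
def torusInvariants (n m : ℕ) : Submodule ℂ (Module.Dual ℂ (irrepSub n m).toSubmodule) where
  carrier := {l | ∀ t ∈ torus, ∀ w, l (irrep n m t w) = l w}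
  add_mem' hk hl t ht w := by simp only [LinearMap.add_apply, hk t ht, hl t ht]
  zero_mem' t _ w := rfl
  smul_mem' c l hl t ht w := by simp only [LinearMap.smul_apply, hl t ht]

instance (n m : ℕ) : FiniteDimensional ℂ (irrepSub n m).toSubmodule := by
  refine Module.Finite.of_injective (N := exps n × exps m → ℂ)
    (LinearMap.pi fun i => coeffs n m i.1 i.2 ∘ₗ (irrepSub n m).toSubmodule.subtype) ?_
  intro x y hxy
  refine Subtype.ext (sub_eq_zero.mp (eq_zero_of_coeffs fun α hα β hβ => ?_))
  rw [map_sub, sub_eq_zero]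
  exact congrFun hxy (⟨α, hα⟩, ⟨β, hβ⟩)

/-- The exponent `(a, b, c)`. -/
def expo (a b c : ℕ) : Fin 3 →₀ ℕ := Finsupp.equivFunOnFinite.symm ![a, b, c]

@[simp] theorem expo_zero (a b c : ℕ) : expo a b c 0 = a := rfl
@[simp] theorem expo_one (a b c : ℕ) : expo a b c 1 = b := rfl
@[simp] theorem expo_two (a b c : ℕ) : expo a b c 2 = c := rfl

theorem eq_expo (α : Fin 3 →₀ ℕ) : α = expo (α 0) (α 1) (α 2) := by
  ext i; fin_cases i <;> rfl

theorem degree_expo (a b c : ℕ) : (expo a b c).degree = a + b + c := by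
  simp [Finsupp.degree_eq_sum, Fin.sum_univ_three]

theorem expo_add_single_zero (a b c : ℕ) : expo a b c + Finsupp.single 0 1 = expo (a + 1) b c := by
  ext i; fin_cases i <;> simp

theorem expo_add_single_one (a b c : ℕ) : expo a b c + Finsupp.single 1 1 = expo a (b + 1) c := by
  ext i; fin_cases i <;> simp

theorem expo_add_single_two (a b c : ℕ) : expo a b c + Finsupp.single 2 1 = expo a b (c + 1) := by
  ext i; fin_cases i <;> simp

/-- The coefficients of weight zero of an element of the irreducible representation are determined
by those with the least exponents of the last variables, since the element is harmonic. -/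
theorem coeffs_eq_zero_of_boundary {M c₁ c₂ : ℕ}
    {w : HPoly (M + 3 * c₁) ⊗[ℂ] HPoly (M + 3 * c₂)} (hw : w ∈ irrepSub (M + 3 * c₁) (M + 3 * c₂))
    (h : ∀ a b, a + b = M →
      coeffs _ _ (expo (a + c₁) (b + c₁) c₁) (expo (a + c₂) (b + c₂) c₂) w = 0)
    (k a b : ℕ) (hk : a + b + k = M) :
    coeffs _ _ (expo (a + c₁) (b + c₁) (k + c₁)) (expo (a + c₂) (b + c₂) (k + c₂)) w = 0 := by
  induction k generalizing a b with
  | zero => simpa using h a b (by omega)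
  | succ k ih =>
    have hrel := sum_coeffs_div_mult_eq_zero hw (α := expo (a + c₁) (b + c₁) (k + c₁))
      (β := expo (a + c₂) (b + c₂) (k + c₂)) (by rw [degree_expo]; omega)
      (by rw [degree_expo]; omega)
    rw [Fin.sum_univ_three] at hrel
    simp only [expo_add_single_zero, expo_add_single_one, expo_add_single_two,
      add_right_comm _ _ 1] at hrel
    rw [ih (a + 1) b (by omega), ih a (b + 1) (by omega), zero_div, zero_div, zero_add, zero_add,
      div_eq_zero_iff] at hrel
    exact hrel.resolve_right (mul_ne_zero (mult_ne_zero _) (mult_ne_zero _))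

/-- The torus invariant functionals embed into the dual of the zero weight space, whose dimension
is at most `M + 1`. The hypotheses make `M` the minimum of `n` and `m`, which are congruent
modulo `3`. -/
theorem rank_torusInvariants_le {n m M c₁ c₂ : ℕ} (hn : n = M + 3 * c₁) (hm : m = M + 3 * c₂)
    (hc : c₁ = 0 ∨ c₂ = 0) :
    Module.rank ℂ (torusInvariants n m) ≤ ((M + 1 : ℕ) : Cardinal) := by
  subst hn hm
  set n := M + 3 * c₁ with hn
  set m := M + 3 * c₂ with hm
  -- `torusElt K` separates the weights, so its eigenspace `F` is the zero weight space.
  let K := 2 * (n + m) + 1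
  let F : Submodule ℂ (irrepSub n m).toSubmodule :=
    { carrier := {w | ∀ α β, ¬ ((K ^ 2 : ℕ) : ℤ) ∣ torusWeight K α - torusWeight K β - 0 →
        coeffs n m α β w = 0}
      add_mem' := fun hx hy α β h => by
        rw [Submodule.coe_add, map_add, hx α β h, hy α β h, add_zero]
      zero_mem' := fun α β _ => map_zero _
      smul_mem' := fun c x hx α β h => by
        rw [Submodule.coe_smul, map_smul, hx α β h, smul_zero] }
  let bd : F →ₗ[ℂ] (Fin (M + 1) → ℂ) := LinearMap.pi fun j =>
    coeffs n m (expo (j + c₁) (M - j + c₁) c₁) (expo (j + c₂) (M - j + c₂) c₂) ∘ₗ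
      (irrepSub n m).toSubmodule.subtype ∘ₗ F.subtype
  have hbd : Function.Injective bd := by
    intro x y hxy
    rw [← sub_eq_zero]
    set w := x - y with hw
    have hbw : bd w = 0 := by rw [hw, map_sub, hxy, sub_self]
    refine Subtype.ext (Subtype.ext (eq_zero_of_coeffs fun α hα β hβ => ?_))
    by_cases hdvd : ((K ^ 2 : ℕ) : ℤ) ∣ torusWeight K α - torusWeight K β - 0
    · rw [mem_exps] at hα hβ
      rw [torusWeight_eq, torusWeight_eq] at hdvd
      obtain ⟨h1, h2⟩ := eq_zero_of_sq_dvd_add_mul (K := K)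
        (a := (α 0 - α 2 - β 0 + β 2 : ℤ)) (b := (α 1 - α 2 - β 1 + β 2 : ℤ))
        (by rw [abs_lt]; omega) (by rw [abs_lt]; omega) (by convert hdvd using 1; ring)
      have hb := coeffs_eq_zero_of_boundary w.1.2 (fun a b hab => by
        have h := congrFun hbw ⟨a, by omega⟩
        obtain rfl : b = M - a := by omega
        exact h) (α 2 - c₁) (α 0 - c₁) (α 1 - c₁) (by omega)
      rw [eq_expo α, eq_expo β]
      convert hb using 3 <;> congr 1 <;> omega
    · exact w.2 α β hdvd
  have hle : Module.finrank ℂ F ≤ M + 1 := by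
    simpa using LinearMap.finrank_le_finrank_of_injective hbd
  let res : torusInvariants n m →ₗ[ℂ] Module.Dual ℂ F := F.subtype.dualMap ∘ₗ Submodule.subtype _
  have hres : Function.Injective res := by
    intro k l hkl
    rw [← sub_eq_zero]
    set l' := k - l with hl'
    have hl0 : ∀ w ∈ F, l'.1 w = 0 := fun w hw => by
      have : res l' = 0 := by rw [hl', map_sub, hkl, sub_self]
      exact LinearMap.congr_fun this ⟨w, hw⟩
    refine Subtype.ext (LinearMap.ext fun w => ?_)
    have hpow : ∀ k : ℕ, l'.1 (irrep n m (torusElt K ^ k) w) = l'.1 w := fun k =>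
      l'.2 _ (pow_mem (torusElt_mem_torus K) k) w
    -- An invariant functional takes the same value on `w` and on its projection `w'` to `F`.
    let w' : (irrepSub n m).toSubmodule := ((K ^ 2 : ℕ) : ℂ)⁻¹ • ∑ k ∈ Finset.range (K ^ 2),
      (rootUnity K ^ (-0 : ℤ)) ^ k • irrep n m (torusElt K ^ k) w
    have hw' : w'.1 = weightProj n m K 0 w.1 := by
      simp only [w', weightProj, Submodule.coe_smul, Submodule.coe_sum]
      rfl
    have hK : ((K ^ 2 : ℕ) : ℂ) ≠ 0 := Nat.cast_ne_zero.mpr (NeZero.ne _)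
    have h1 : l'.1 w' = l'.1 w := by
      simp only [w', map_smul, map_sum, hpow]
      simp only [neg_zero, zpow_zero, one_pow, Finset.sum_const, Finset.card_range,
        nsmul_eq_mul, smul_eq_mul]
      rw [one_mul, ← mul_assoc, inv_mul_cancel₀ hK, one_mul]
    rw [← h1]
    refine hl0 w' fun α β h => ?_
    rw [hw', coeffs_weightProj, if_neg h]
  have hfin : Module.finrank ℂ (torusInvariants n m) ≤ M + 1 :=
    (LinearMap.finrank_le_finrank_of_injective hres).trans
      ((Subspace.dual_finrank_eq (K := ℂ) (V := F)).le.trans hle)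
  rw [← Module.finrank_eq_rank]
  exact_mod_cast hfin

/-! ### The algebra containing all the spaces `Hilb(p)` -/

/-- The underlying space of `Hilb(p)`. -/
abbrev HilbSpace (p : ℕ) : Type := HPoly p ⊗[ℂ] (HPoly p ⊗[ℂ] HPoly p)

/-- The algebra of polynomials in three vectors of `ℂ³`, i.e. in the columns of a matrix. -/
def TriPoly : Type :=
  MvPolynomial (Fin 3) ℂ ⊗[ℂ] (MvPolynomial (Fin 3) ℂ ⊗[ℂ] MvPolynomial (Fin 3) ℂ)

instance : CommRing TriPoly := inferInstanceAs (CommRing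
  (MvPolynomial (Fin 3) ℂ ⊗[ℂ] (MvPolynomial (Fin 3) ℂ ⊗[ℂ] MvPolynomial (Fin 3) ℂ)))

instance : Algebra ℂ TriPoly := inferInstanceAs (Algebra ℂ
  (MvPolynomial (Fin 3) ℂ ⊗[ℂ] (MvPolynomial (Fin 3) ℂ ⊗[ℂ] MvPolynomial (Fin 3) ℂ)))

/-- The identification of `TriPoly` with the tensor product that defines it. -/
def triEquiv :
    MvPolynomial (Fin 3) ℂ ⊗[ℂ] (MvPolynomial (Fin 3) ℂ ⊗[ℂ] MvPolynomial (Fin 3) ℂ) ≃ₐ[ℂ]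
      TriPoly :=
  AlgEquiv.refl

/-- The product of three polynomials, one in each of the three vectors. -/
def triTmul (f g h : MvPolynomial (Fin 3) ℂ) : TriPoly := triEquiv (f ⊗ₜ (g ⊗ₜ h))

theorem triTmul_mul (f g h f' g' h' : MvPolynomial (Fin 3) ℂ) :
    triTmul f g h * triTmul f' g' h' = triTmul (f * f') (g * g') (h * h') := by
  rw [triTmul, triTmul, triTmul, ← map_mul, Algebra.TensorProduct.tmul_mul_tmul,
    Algebra.TensorProduct.tmul_mul_tmul]

/-- The inclusion of a space of polynomials of given degrees in the three vectors. -/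
def triIncl (a b c : ℕ) : HPoly a ⊗[ℂ] (HPoly b ⊗[ℂ] HPoly c) →ₗ[ℂ] TriPoly :=
  triEquiv.toLinearMap ∘ₗ TensorProduct.map (HPoly a).subtype
    (TensorProduct.map (HPoly b).subtype (HPoly c).subtype)

theorem triIncl_injective (a b c : ℕ) : Function.Injective (triIncl a b c) :=
  triEquiv.injective.comp (TensorProduct.map_injective_of_flat_flat _ _ Subtype.val_injective
    (TensorProduct.map_injective_of_flat_flat _ _ Subtype.val_injective Subtype.val_injective))

@[simp]
theorem triIncl_tmul (a b c : ℕ) (f : HPoly a) (g : HPoly b) (h : HPoly c) :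
    triIncl a b c (f ⊗ₜ (g ⊗ₜ h)) = triTmul f.1 g.1 h.1 := rfl

theorem triIncl_induction {a b c : ℕ} {P : HPoly a ⊗[ℂ] (HPoly b ⊗[ℂ] HPoly c) → Prop}
    (x : HPoly a ⊗[ℂ] (HPoly b ⊗[ℂ] HPoly c)) (zero : P 0)
    (add : ∀ x y, P x → P y → P (x + y)) (tmul : ∀ f g h, P (f ⊗ₜ (g ⊗ₜ h))) : P x := by
  induction x with
  | zero => exact zero
  | add x y hx hy => exact add x y hx hy
  | tmul f y =>
    induction y with
    | zero => rwa [TensorProduct.tmul_zero]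
    | add x y hx hy => rw [TensorProduct.tmul_add]; exact add _ _ hx hy
    | tmul g h => exact tmul f g h

/-- Evaluation of a polynomial in three vectors, with values in a commutative algebra. -/
def triEval {R : Type} [CommRing R] [Algebra ℂ R] (c : Fin 3 → Fin 3 → R) : TriPoly →ₐ[ℂ] R :=
  (Algebra.TensorProduct.productMap (MvPolynomial.aeval (c 0)) (Algebra.TensorProduct.productMap
    (MvPolynomial.aeval (c 1)) (MvPolynomial.aeval (c 2)))).comp triEquiv.symm.toAlgHom

theorem triPoly_induction {P : TriPoly → Prop} (x : TriPoly) (zero : P 0)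
    (add : ∀ x y, P x → P y → P (x + y)) (tmul : ∀ f g h, P (triTmul f g h)) : P x := by
  obtain ⟨x, rfl⟩ := triEquiv.surjective x
  induction x with
  | zero => rwa [map_zero]
  | add x y hx hy => rw [map_add]; exact add _ _ hx hy
  | tmul f y =>
    induction y with
    | zero => rwa [TensorProduct.tmul_zero, map_zero]
    | add x y hx hy => rw [TensorProduct.tmul_add, map_add]; exact add _ _ hx hy
    | tmul g h => exact tmul f g h

theorem triEval_tmul {R : Type} [CommRing R] [Algebra ℂ R] (c : Fin 3 → Fin 3 → R)
    (f g h : MvPolynomial (Fin 3) ℂ) :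
    triEval c (triTmul f g h) = MvPolynomial.aeval (c 0) f *
      (MvPolynomial.aeval (c 1) g * MvPolynomial.aeval (c 2) h) := by
  simp [triEval, triTmul]

/-- The coordinate `i` of the vector `k`, as a polynomial. -/
def triVar (k i : Fin 3) : TriPoly :=
  ![triTmul (MvPolynomial.X i) 1 1, triTmul 1 (MvPolynomial.X i) 1,
    triTmul 1 1 (MvPolynomial.X i)] k

@[simp]
theorem triEval_triVar {R : Type} [CommRing R] [Algebra ℂ R] (c : Fin 3 → Fin 3 → R)
    (k i : Fin 3) : triEval c (triVar k i) = c k i := by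
  fin_cases k <;> simp [triVar, triEval_tmul]

theorem triPoly_algHom_ext {R : Type} [CommRing R] [Algebra ℂ R] {φ ψ : TriPoly →ₐ[ℂ] R}
    (h : ∀ k i, φ (triVar k i) = ψ (triVar k i)) : φ = ψ := by
  suffices φ.comp triEquiv.toAlgHom = ψ.comp triEquiv.toAlgHom from
    AlgHom.ext fun x => DFunLike.congr_fun this (triEquiv.symm x)
  apply Algebra.TensorProduct.ext
  · ext i; exact h 0 i
  · apply Algebra.TensorProduct.ext
    · ext i; exact h 1 i
    · ext i; exact h 2 i

theorem algHom_comp_triEval {R S : Type} [CommRing R] [Algebra ℂ R] [CommRing S] [Algebra ℂ S]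
    (φ : R →ₐ[ℂ] S) (c : Fin 3 → Fin 3 → R) (x : TriPoly) :
    φ (triEval c x) = triEval (fun k i => φ (c k i)) x := by
  rw [← AlgHom.comp_apply]
  congr 1
  apply triPoly_algHom_ext
  simp

/-- The action of a matrix on polynomials in three vectors. -/
def triAct (A : Matrix (Fin 3) (Fin 3) ℂ) : TriPoly →ₐ[ℂ] TriPoly :=
  (triEquiv.toAlgHom.comp (Algebra.TensorProduct.map (linSubst A)
    (Algebra.TensorProduct.map (linSubst A) (linSubst A)))).comp triEquiv.symm.toAlgHom

theorem triAct_triTmul (A : Matrix (Fin 3) (Fin 3) ℂ) (f g h : MvPolynomial (Fin 3) ℂ) :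
    triAct A (triTmul f g h) = triTmul (linSubst A f) (linSubst A g) (linSubst A h) := rfl

theorem triAct_triVar (A : Matrix (Fin 3) (Fin 3) ℂ) (k j : Fin 3) :
    triAct A (triVar k j) = ∑ i, A i j • triVar k i := by
  have hX : linSubst A (MvPolynomial.X j) = ∑ i, A i j • MvPolynomial.X i := by
    simp [linSubst, MvPolynomial.smul_eq_C_mul]
  fin_cases k <;>
  · simp only [triVar, Fin.mk_one, Fin.zero_eta, Fin.reduceFinMk, Matrix.cons_val,
      triAct_triTmul, hX, map_one]
    simp only [triTmul, TensorProduct.sum_tmul, TensorProduct.tmul_sum, ← TensorProduct.smul_tmul',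
      TensorProduct.tmul_smul, map_sum, map_smul]

theorem triIncl_Hilb (p : ℕ) (g : SU3) (x : HilbSpace p) :
    triIncl p p p (Hilb p g x) = triAct (fund g) (triIncl p p p x) := by
  induction x using triIncl_induction with
  | zero => simp
  | add x y hx hy => simp only [map_add, hx, hy]
  | tmul f g h => rfl

theorem triEval_triAct {R : Type} [CommRing R] [Algebra ℂ R] (A : Matrix (Fin 3) (Fin 3) ℂ)
    (c : Fin 3 → Fin 3 → R) (x : TriPoly) :
    triEval c (triAct A x) = triEval (fun k j => ∑ i, A i j • c k i) x := by
  rw [← AlgHom.comp_apply]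
  congr 1
  apply triPoly_algHom_ext
  intro k i
  simp [triAct_triVar]

/-- A polynomial in three vectors is determined by its values. -/
theorem eq_zero_of_triEval {x : TriPoly} (h : ∀ c : Fin 3 → Fin 3 → ℂ, triEval c x = 0) :
    x = 0 := by
  have key : ∀ {A I : Type} [CommRing A] [Algebra ℂ A] (χ : I → A →ₐ[ℂ] ℂ)
      (_ : ∀ a, (∀ i, χ i a = 0) → a = 0) (y : MvPolynomial (Fin 3) ℂ ⊗[ℂ] A),
      (∀ i (c : Fin 3 → ℂ), Algebra.TensorProduct.productMap (MvPolynomial.aeval c) (χ i) y = 0) →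
      y = 0 := by
    intro A I _ _ χ hχ y hy
    let e := (Algebra.TensorProduct.comm ℂ (MvPolynomial (Fin 3) ℂ) A).trans
      ((MvPolynomial.algebraTensorAlgEquiv (σ := Fin 3) ℂ A).restrictScalars ℂ)
    have he : ∀ i (c : Fin 3 → ℂ) z,
        MvPolynomial.eval c (MvPolynomial.map (χ i).toRingHom (e z)) =
          Algebra.TensorProduct.productMap (MvPolynomial.aeval c) (χ i) z := by
      intro i c z
      induction z with
      | zero => simp
      | add x y hx hy => simp only [map_add, hx, hy]
      | tmul f a =>
        simp only [e, AlgEquiv.trans_apply, Algebra.TensorProduct.comm_tmul,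
          AlgEquiv.restrictScalars_apply, MvPolynomial.algebraTensorAlgEquiv_tmul,
          Algebra.TensorProduct.productMap_apply_tmul]
        rw [MvPolynomial.smul_eq_C_mul, map_mul, map_mul, MvPolynomial.map_C, MvPolynomial.eval_C,
          MvPolynomial.map_map]
        have : (χ i).toRingHom.comp (algebraMap ℂ A) = RingHom.id ℂ := by
          ext z; simp
        rw [this, MvPolynomial.map_id, mul_comm]
        rfl
    apply e.injective
    rw [map_zero]
    ext d
    rw [MvPolynomial.coeff_zero]
    refine hχ _ fun i => ?_
    have h0 : MvPolynomial.map (χ i).toRingHom (e y) = 0 := by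
      apply MvPolynomial.funext
      intro c
      rw [he, hy, map_zero]
    have := congrArg (MvPolynomial.coeff d) h0
    rwa [MvPolynomial.coeff_map, MvPolynomial.coeff_zero] at this
  have k1 : ∀ a : MvPolynomial (Fin 3) ℂ, (∀ c : Fin 3 → ℂ, MvPolynomial.aeval c a = 0) → a = 0 :=
    fun a ha => MvPolynomial.funext fun c => by
      rw [map_zero, ← ha c, MvPolynomial.aeval_eq_eval]
  apply triEquiv.symm.injective
  rw [map_zero]
  refine key (fun c : (Fin 3 → ℂ) × (Fin 3 → ℂ) => Algebra.TensorProduct.productMap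
    (MvPolynomial.aeval c.1) (MvPolynomial.aeval c.2)) (fun a ha => ?_) (triEquiv.symm x)
    fun c d => ?_
  · exact key (fun c : Fin 3 → ℂ => MvPolynomial.aeval c) k1 a fun c d => ha (d, c)
  · exact h ![d, c.1, c.2]

/-! ### Absence of the representation from `Hilb(p)` -/

theorem ambient_torusElt_highestWeightVector (n m K : ℕ) [NeZero K] :
    ambient n m (torusElt K) (highestWeightVector n m) =
      rootUnity K ^ (n + m + K * m : ℤ) • highestWeightVector n m := by
  rw [← sub_eq_zero]
  refine eq_zero_of_coeffs fun α hα β hβ => ?_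
  rw [map_sub, map_smul, coeffs_torusElt, coeffs_highestWeightVector]
  split_ifs with h
  · rw [h.1, h.2, torusWeight_eq, torusWeight_eq, sub_eq_zero, smul_eq_mul]
    simp only [ne_eq, Fin.reduceEq, not_false_eq_true, Finsupp.single_eq_same,
        Finsupp.single_eq_of_ne]
    congr 2
    push_cast
    ring
  · simp

/-- The highest weight vector as an element of the irreducible representation. -/
def hwVector (n m : ℕ) : (irrepSub n m).toSubmodule :=
  ⟨highestWeightVector n m, highestWeightVector_mem_irrepSub n m⟩

theorem intertwiner_eq_zero {n m : ℕ} {W : Type} [AddCommMonoid W] [Module ℂ W]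
    {σ : Representation ℂ SU3 W} (φ : Representation.IntertwiningMap (irrep n m) σ)
    (h : φ (hwVector n m) = 0) : φ = 0 := by
  have hle : (irrepSub n m).toSubmodule ≤
      (LinearMap.ker φ.toLinearMap).map (irrepSub n m).toSubmodule.subtype := by
    refine Submodule.span_le.mpr ?_
    rintro _ ⟨g, rfl⟩
    refine ⟨irrep n m g (hwVector n m), ?_, rfl⟩
    have := LinearMap.congr_fun (φ.isIntertwining' g) (hwVector n m)
    refine LinearMap.mem_ker.mpr (this.trans ?_)
    change σ g (φ (hwVector n m)) = 0
    rw [h, map_zero]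
  apply Representation.IntertwiningMap.ext
  ext w
  obtain ⟨w', hw', h'⟩ := hle w.2
  rw [← Subtype.ext (a1 := w') (a2 := w) h']
  exact hw'

/-- The functional taking the coefficient of the monomial with the given exponents. -/
def triCoeff (a b c : Fin 3 →₀ ℕ) : TriPoly →ₗ[ℂ] ℂ :=
  let B := MvPolynomial.basisMonomials (Fin 3) ℂ
  Finsupp.lapply (a, b, c) ∘ₗ (B.tensorProduct (B.tensorProduct B)).repr.toLinearMap ∘ₗ
    triEquiv.symm.toLinearMap

theorem triCoeff_tmul (a b c : Fin 3 →₀ ℕ) (f g h : MvPolynomial (Fin 3) ℂ) :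
    triCoeff a b c (triTmul f g h) = f.coeff a * (g.coeff b * h.coeff c) := by
  simp only [triCoeff, triTmul, LinearMap.comp_apply, LinearEquiv.coe_coe,
    AlgEquiv.toLinearMap_apply, AlgEquiv.symm_apply_apply, Finsupp.lapply_apply,
    Module.Basis.tensorProduct_repr_tmul_apply, smul_eq_mul]
  rw [mul_comm, mul_comm (g.coeff b)]
  rfl

theorem eq_zero_of_triCoeff {x : TriPoly} (h : ∀ a b c, triCoeff a b c x = 0) : x = 0 := by
  let B := MvPolynomial.basisMonomials (Fin 3) ℂ
  apply triEquiv.symm.injective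
  apply (B.tensorProduct (B.tensorProduct B)).repr.injective
  ext ⟨a, b, c⟩
  rw [map_zero, map_zero]
  exact h a b c

theorem triCoeff_triIncl_Hilb {p : ℕ} (K : ℕ) [NeZero K] (a b c : Fin 3 →₀ ℕ) (x : HilbSpace p) :
    triCoeff a b c (triIncl p p p (Hilb p (torusElt K) x)) =
      rootUnity K ^ (torusWeight K a + torusWeight K b + torusWeight K c) *
        triCoeff a b c (triIncl p p p x) := by
  rw [triIncl_Hilb]
  induction x using triIncl_induction with
  | zero => simp
  | add x y hx hy => simp only [map_add, hx, hy, mul_add]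
  | tmul f g h =>
    have h0 := rootUnity_ne_zero K
    have h1 : fund (torusElt K) = Matrix.diagonal fun i => rootUnity K ^ torusExponent K i := rfl
    rw [triIncl_tmul, triAct_triTmul, triCoeff_tmul, triCoeff_tmul, h1,
      coeff_linSubst_diagonal, coeff_linSubst_diagonal, coeff_linSubst_diagonal,
      monom_torusElt, monom_torusElt, monom_torusElt, zpow_add₀ h0,
      zpow_add₀ h0]
    ring

theorem triCoeff_triIncl_eq_zero {p : ℕ} {a b c : Fin 3 →₀ ℕ} (x : HilbSpace p)
    (h : ¬ (a ∈ exps p ∧ b ∈ exps p ∧ c ∈ exps p)) : triCoeff a b c (triIncl p p p x) = 0 := by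
  induction x using triIncl_induction with
  | zero => simp
  | add x y hx hy => simp only [map_add, hx, hy, add_zero]
  | tmul f g k =>
    rw [triIncl_tmul, triCoeff_tmul]
    by_cases ha : a ∈ exps p
    · by_cases hb : b ∈ exps p
      · rw [coeff_eq_zero_of_notMem_exps k fun hc => h ⟨ha, hb, hc⟩, mul_zero, mul_zero]
      · rw [coeff_eq_zero_of_notMem_exps g hb, zero_mul, mul_zero]
    · rw [coeff_eq_zero_of_notMem_exps f ha, zero_mul]

/-- Every intertwiner to `Hilb(p)` kills the highest weight vector, since its weight does not occur
there: the exponents of the three coordinates would have to be `n + m - 1`, `m - 1` and `-1`. -/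
theorem intertwiner_Hilb_eq_zero {n m p : ℕ} (h : n + 2 * m = 3 * (p + 1))
    (φ : Representation.IntertwiningMap (irrep n m) (Hilb p)) : φ = 0 := by
  apply intertwiner_eq_zero
  let K := 3 * p + n + m + 1
  set x := φ (hwVector n m) with hx
  have hτ : Hilb p (torusElt K) x = rootUnity K ^ (n + m + K * m : ℤ) • x := by
    have h1 : irrep n m (torusElt K) (hwVector n m) =
        rootUnity K ^ (n + m + K * m : ℤ) • hwVector n m :=
      Subtype.ext (ambient_torusElt_highestWeightVector n m K)
    have h2 := LinearMap.congr_fun (φ.isIntertwining' (torusElt K)) (hwVector n m)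
    rw [LinearMap.comp_apply, h1, map_smul] at h2
    exact h2.symm
  apply triIncl_injective
  rw [map_zero]
  refine eq_zero_of_triCoeff fun a b c => ?_
  by_contra hne
  have hmem : a ∈ exps p ∧ b ∈ exps p ∧ c ∈ exps p := by
    by_contra h'
    exact hne (triCoeff_triIncl_eq_zero x h')
  simp only [mem_exps] at hmem
  have h1 := triCoeff_triIncl_Hilb K a b c x
  rw [hτ, map_smul, map_smul, smul_eq_mul] at h1
  have h2 := mul_right_cancel₀ hne h1
  have h3 : rootUnity K ^ (torusWeight K a + torusWeight K b + torusWeight K c -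
      (n + m + K * m : ℤ)) = 1 := by
    rw [zpow_sub₀ (rootUnity_ne_zero K), ← h2, div_self (zpow_ne_zero _ (rootUnity_ne_zero K))]
  have h4 := ((rootUnity_isPrimitiveRoot K).zpow_eq_one_iff_dvd _).mp h3
  simp only [torusWeight_eq] at h4
  obtain ⟨h5, h6⟩ := eq_zero_of_sq_dvd_add_mul (K := K)
    (a := (a 0 + b 0 + c 0 - a 2 - b 2 - c 2 : ℤ) - n - m)
    (b := (a 1 + b 1 + c 1 - a 2 - b 2 - c 2 : ℤ) - m)
    (by rw [abs_lt]; omega) (by rw [abs_lt]; omega) (by convert h4 using 1; ring)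
  omega

/-! ### Density of `SU(3)` for polynomials homogeneous in the columns -/

/-- A complex number and its conjugate are algebraically independent. -/
theorem eq_zero_of_eval_conj {P : MvPolynomial (Fin 2) ℂ}
    (h : ∀ z : ℂ, MvPolynomial.eval ![z, star z] P = 0) : P = 0 := by
  -- In the coordinates `z = x + i y` the hypothesis says that `P` vanishes for all real `x`, `y`.
  let φ : MvPolynomial (Fin 2) ℂ →ₐ[ℂ] MvPolynomial (Fin 2) ℂ := MvPolynomial.aeval
    ![MvPolynomial.X 0 + MvPolynomial.C Complex.I * MvPolynomial.X 1,
      MvPolynomial.X 0 - MvPolynomial.C Complex.I * MvPolynomial.X 1]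
  have hφ : ∀ (Q : MvPolynomial (Fin 2) ℂ) (x : Fin 2 → ℂ), MvPolynomial.eval x (φ Q) =
      MvPolynomial.eval ![x 0 + Complex.I * x 1, x 0 - Complex.I * x 1] Q := by
    intro Q x
    change ((MvPolynomial.eval x).comp φ.toRingHom) Q = _
    congr 1
    apply MvPolynomial.ringHom_ext
    · intro r
      simp [φ]
    · intro i
      fin_cases i <;> simp [φ]
  have h0 : φ P = 0 := by
    refine MvPolynomial.funext_set (fun _ => Set.range ((↑) : ℝ → ℂ))
      (fun _ => Set.infinite_range_of_injective Complex.ofReal_injective) fun x hx => ?_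
    obtain ⟨a, ha⟩ := hx 0 trivial
    obtain ⟨b, hb⟩ := hx 1 trivial
    rw [hφ, map_zero, ← ha, ← hb, ← h (a + Complex.I * b)]
    congr 2
    ext i
    fin_cases i <;> simp [sub_eq_add_neg]
  apply MvPolynomial.funext
  intro x
  have := hφ P ![(x 0 + x 1) / 2, (x 0 - x 1) / (2 * Complex.I)]
  rw [h0, map_zero] at this
  rw [map_zero, this]
  congr 2
  have hI := Complex.I_ne_zero
  ext i
  fin_cases i <;> · simp; field_simp; ring

/-- A polynomial that vanishes on an affine family depending on `z` and its conjugate vanishes on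
the family in which these are independent variables. -/
theorem triEval_affine {X : TriPoly} (c d e : Fin 3 → Fin 3 → ℂ)
    (h : ∀ z : ℂ, triEval (fun k => c k + z • d k + star z • e k) X = 0) (s t : ℂ) :
    triEval (fun k => c k + s • d k + t • e k) X = 0 := by
  let C : Fin 3 → Fin 3 → MvPolynomial (Fin 2) ℂ := fun k i =>
    MvPolynomial.C (c k i) + MvPolynomial.X 0 * MvPolynomial.C (d k i) +
      MvPolynomial.X 1 * MvPolynomial.C (e k i)
  have key : ∀ s t : ℂ, MvPolynomial.aeval ![s, t] (triEval C X) =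
      triEval (fun k => c k + s • d k + t • e k) X := fun s t => by
    rw [algHom_comp_triEval]
    congr 2
    funext k i
    simp [C]
  have h0 : triEval C X = 0 := eq_zero_of_eval_conj fun z => by
    rw [← MvPolynomial.aeval_eq_eval, key]
    exact h z
  rw [← key, h0, map_zero]

/-- Three pairwise orthogonal nonzero vectors of `ℂ³`. -/
structure IsFrame (a b c : Fin 3 → ℂ) : Prop where
  ab : star a ⬝ᵥ b = 0
  bc : star b ⬝ᵥ c = 0
  ca : star c ⬝ᵥ a = 0
  a_ne : a ≠ 0
  b_ne : b ≠ 0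
  c_ne : c ≠ 0

open ComplexOrder in
theorem star_dotProduct_self_ne_zero {v : Fin 3 → ℂ} (hv : v ≠ 0) : star v ⬝ᵥ v ≠ 0 :=
  fun h => hv (dotProduct_star_self_eq_zero.mp h)

theorem star_dotProduct_comm_eq_zero {a b : Fin 3 → ℂ} (h : star a ⬝ᵥ b = 0) :
    star b ⬝ᵥ a = 0 := by
  have h' := congrArg star h
  simpa [dotProduct, mul_comm] using h'

theorem IsFrame.rotate {a b c : Fin 3 → ℂ} (h : IsFrame a b c) : IsFrame b c a :=
  ⟨h.bc, h.ca, h.ab, h.b_ne, h.c_ne, h.a_ne⟩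

theorem IsFrame.swap {a b c : Fin 3 → ℂ} (h : IsFrame a b c) : IsFrame b a c :=
  ⟨star_dotProduct_comm_eq_zero h.ab, star_dotProduct_comm_eq_zero h.ca,
    star_dotProduct_comm_eq_zero h.bc, h.b_ne, h.a_ne, h.c_ne⟩

theorem add_smul_ne_zero_of_orthogonal {a b : Fin 3 → ℂ} (hab : star a ⬝ᵥ b = 0) (ha : a ≠ 0)
    (z : ℂ) : a + z • b ≠ 0 := fun h => by
  have : star a ⬝ᵥ (a + z • b) = 0 := by rw [h, dotProduct_zero]
  rw [dotProduct_add, dotProduct_smul, hab, smul_zero, add_zero] at this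
  exact star_dotProduct_self_ne_zero ha this

/-- Rotation of two vectors of a frame in the plane that they span. -/
theorem IsFrame.rotation {a b c : Fin 3 → ℂ} (h : IsFrame a b c) :
    ∃ κ : ℂ, ∀ z : ℂ, IsFrame (a + z • b) (b + star z • κ • a) c := by
  have hN : star a ⬝ᵥ a ≠ 0 := star_dotProduct_self_ne_zero h.a_ne
  have hba := star_dotProduct_comm_eq_zero h.ab
  refine ⟨-(star b ⬝ᵥ b) / (star a ⬝ᵥ a), fun z => ⟨?_, ?_, ?_, ?_, ?_, h.c_ne⟩⟩
  · simp only [star_add, star_smul, add_dotProduct, dotProduct_add, smul_dotProduct,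
      dotProduct_smul, h.ab, hba, smul_eq_mul]
    field_simp
    ring
  · simp [add_dotProduct, smul_dotProduct, h.bc, star_dotProduct_comm_eq_zero h.ca]
  · simp [dotProduct_add, dotProduct_smul, h.ca, star_dotProduct_comm_eq_zero h.bc]
  · exact add_smul_ne_zero_of_orthogonal h.ab h.a_ne z
  · rw [smul_smul]
    exact add_smul_ne_zero_of_orthogonal hba h.b_ne _

theorem monom_smul {R : Type} [CommRing R] {n : ℕ} {α : Fin 3 →₀ ℕ} (hα : α ∈ exps n) (s : R)
    (c : Fin 3 → R) : monom α (fun i => s * c i) = s ^ n * monom α c := by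
  rw [mem_exps] at hα
  simp only [monom, mul_pow, Finset.prod_mul_distrib, Fin.prod_univ_three, ← pow_add, hα]

theorem aeval_smul_HPoly {R : Type} [CommRing R] [Algebra ℂ R] {n : ℕ} (f : HPoly n) (s : R)
    (c : Fin 3 → R) :
    MvPolynomial.aeval (fun i => s * c i) f.1 = s ^ n * MvPolynomial.aeval c f.1 := by
  rw [aeval_eq_sum_exps, aeval_eq_sum_exps, Finset.mul_sum]
  refine Finset.sum_congr rfl fun α hα => ?_
  rw [monom_smul hα, mul_smul_comm]

theorem triEval_smul {R : Type} [CommRing R] [Algebra ℂ R] {q : ℕ} (x : HilbSpace q)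
    (s : Fin 3 → R) (c : Fin 3 → Fin 3 → R) :
    triEval (fun k i => s k * c k i) (triIncl q q q x) =
      (s 0 * s 1 * s 2) ^ q * triEval c (triIncl q q q x) := by
  induction x using triIncl_induction with
  | zero => simp
  | add x y hx hy => simp only [map_add, hx, hy, mul_add]
  | tmul f g h =>
    rw [triIncl_tmul, triEval_tmul, triEval_tmul, aeval_smul_HPoly, aeval_smul_HPoly,
      aeval_smul_HPoly]
    ring

/-- The columns of a matrix of `SU(3)`. -/
def cols (g : SU3) : Fin 3 → Fin 3 → ℂ := fun k i => fund g i k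

/-- By homogeneity in each column, vanishing on `SU(3)` implies vanishing on all frames: they can be
normalized, and the determinant corrected by a scalar in the first column. -/
theorem triEval_frame_eq_zero {q : ℕ} {x : HilbSpace q}
    (hx : ∀ g : SU3, triEval (cols g) (triIncl q q q x) = 0) {a b c : Fin 3 → ℂ}
    (h : IsFrame a b c) : triEval ![a, b, c] (triIncl q q q x) = 0 := by
  set u : Fin 3 → Fin 3 → ℂ := ![a, b, c] with hu
  have hne : ∀ k, u k ≠ 0 := by
    intro k; fin_cases k
    exacts [h.a_ne, h.b_ne, h.c_ne]
  have horth : ∀ k l, k ≠ l → star (u k) ⬝ᵥ u l = 0 := by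
    intro k l hkl
    fin_cases k <;> fin_cases l <;> first | exact absurd rfl hkl | skip
    exacts [h.ab, h.swap.bc, h.swap.ab, h.bc, h.ca, h.swap.ca]
  let N : Fin 3 → ℝ := fun k => Real.sqrt (∑ i, Complex.normSq (u k i))
  have hpos : ∀ k, 0 < ∑ i, Complex.normSq (u k i) := fun k => by
    obtain ⟨i, hi⟩ := Function.ne_iff.mp (hne k)
    exact Finset.sum_pos' (fun i _ => Complex.normSq_nonneg _)
      ⟨i, Finset.mem_univ _, Complex.normSq_pos.mpr hi⟩
  have hN : ∀ k, (N k : ℂ) ≠ 0 := fun k =>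
    Complex.ofReal_ne_zero.mpr (Real.sqrt_pos.mpr (hpos k)).ne'
  have hN2 : ∀ k, star (u k) ⬝ᵥ u k = (N k : ℂ) * N k := fun k => by
    rw [← Complex.ofReal_mul, Real.mul_self_sqrt (hpos k).le, dotProduct]
    push_cast
    refine Finset.sum_congr rfl fun i _ => ?_
    rw [Pi.star_apply, Complex.normSq_eq_conj_mul_self]
    rfl
  let U : Matrix (Fin 3) (Fin 3) ℂ := fun i k => (N k : ℂ)⁻¹ * u k i
  have hU : star U * U = 1 := by
    ext k l
    have h1 : (star U * U) k l = (N k : ℂ)⁻¹ * (N l : ℂ)⁻¹ * (star (u k) ⬝ᵥ u l) := by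
      rw [Matrix.mul_apply, dotProduct, Finset.mul_sum]
      refine Finset.sum_congr rfl fun i _ => ?_
      have h2 : (star U) k i = (N k : ℂ)⁻¹ * star (u k i) := by
        rw [Matrix.star_apply]
        simp only [U, star_mul', star_inv₀, Complex.star_def, Complex.conj_ofReal]
      rw [h2, Pi.star_apply]
      ring
    rw [h1, Matrix.one_apply]
    split_ifs with hkl
    · subst hkl
      have := hN k
      rw [hN2]
      field_simp
    · rw [horth k l hkl, mul_zero]
  have hdet : star U.det * U.det = 1 := by
    have := congrArg Matrix.det hU
    rwa [Matrix.det_mul, Matrix.det_one, Matrix.star_eq_conjTranspose,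
      Matrix.det_conjTranspose] at this
  let D : Fin 3 → ℂ := ![U.det, 1, 1]
  have hD : ∀ k, D k * star (D k) = 1 := by
    intro k
    fin_cases k
    · simpa [D, mul_comm] using hdet
    · simp [D]
    · simp [D]
  let g : SU3 := ⟨U * Matrix.diagonal (star D), by
    rw [Matrix.mem_specialUnitaryGroup_iff, Matrix.mem_unitaryGroup_iff']
    constructor
    · rw [star_mul, mul_assoc, ← mul_assoc (star U), hU, one_mul, Matrix.star_eq_conjTranspose,
        Matrix.diagonal_conjTranspose, Matrix.diagonal_mul_diagonal, ← Matrix.diagonal_one]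
      congr 1
      funext k
      simpa using hD k
    · rw [Matrix.det_mul, Matrix.det_diagonal, Fin.prod_univ_three, mul_comm]
      simpa [D] using hdet⟩
  have hug : u = fun k i => (N k * D k) * cols g k i := by
    funext k i
    have : cols g k i = U i k * star (D k) := by
      simp [cols, fund, g, Matrix.mul_diagonal]
    rw [this]
    simp only [U]
    have h1 := hN k
    calc u k i = (N k * (N k : ℂ)⁻¹) * (D k * star (D k)) * u k i := by
          rw [hD, mul_inv_cancel₀ h1, one_mul, one_mul]
      _ = _ := by ring
  rw [hug, triEval_smul x (fun k => N k * D k) (cols g), hx g, mul_zero]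

/-- When `z` and its conjugate are treated as independent variables, the rotations of two vectors of
a frame become shears; three of them make up the unitriangular transformations. -/
theorem triEval_triangular_eq_zero {q : ℕ} {x : HilbSpace q}
    (hx : ∀ g : SU3, triEval (cols g) (triIncl q q q x) = 0) {a b c : Fin 3 → ℂ}
    (h : IsFrame a b c) (s r k : ℂ) :
    triEval ![a + s • b + r • c, b + k • c, c] (triIncl q q q x) = 0 := by
  have h1 : ∀ {a b c : Fin 3 → ℂ}, IsFrame a b c → ∀ s : ℂ,
      triEval ![a + s • b, b, c] (triIncl q q q x) = 0 := by
    intro a b c h s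
    obtain ⟨κ, hκ⟩ := h.rotation
    have := triEval_affine (X := triIncl q q q x) ![a, b, c] ![b, 0, 0] ![0, κ • a, 0] (fun z => by
      rw [← triEval_frame_eq_zero hx (hκ z)]
      congr 2
      funext k
      fin_cases k <;> simp) s 0
    rw [← this]
    congr 2
    funext k
    fin_cases k <;> simp
  have h2 : ∀ {a b c : Fin 3 → ℂ}, IsFrame a b c → ∀ s z : ℂ,
      triEval ![a + s • (b + z • c), b + z • c, c] (triIncl q q q x) = 0 := by
    intro a b c h s z
    obtain ⟨κ, hκ⟩ := h.rotate.rotation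
    have := triEval_affine (X := triIncl q q q x) ![a + s • b, b, c] ![s • c, c, 0]
      ![0, 0, κ • b] (fun z => by
        rw [← h1 (hκ z).rotate.rotate s]
        congr 2
        funext k
        fin_cases k <;> simp [add_assoc, smul_smul, mul_comm]) z 0
    rw [← this]
    congr 2
    funext k
    fin_cases k <;> simp [add_assoc, smul_smul, mul_comm]
  obtain ⟨κ, hκ⟩ := h.rotate.rotate.swap.rotation
  have := triEval_affine (X := triIncl q q q x) ![a + s • (b + k • c), b + k • c, c] ![c, 0, 0]
    ![(s * k) • κ • a, k • κ • a, κ • a] (fun z => by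
      rw [← h2 (hκ z).rotate.rotate.swap s k]
      congr 2
      funext k
      fin_cases k <;> simp <;> module) (r - s * k) 0
  rw [← this]
  congr 2
  funext k
  fin_cases k <;> (simp; try module)

/-- Gram–Schmidt: the rows of an invertible matrix arise from a frame by a unitriangular
transformation. -/
theorem exists_isFrame {C : Matrix (Fin 3) (Fin 3) ℂ} (hC : C.det ≠ 0) :
    ∃ a b c : Fin 3 → ℂ, ∃ s r k : ℂ, IsFrame a b c ∧
      C = Matrix.of ![a + s • b + r • c, b + k • c, c] := by
  have hdet : ∀ (a b c : Fin 3 → ℂ) (s r k : ℂ),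
      C = Matrix.of ![a + s • b + r • c, b + k • c, c] → a ≠ 0 ∧ b ≠ 0 ∧ c ≠ 0 := by
    rintro a b c s r k rfl
    refine ⟨?_, ?_, ?_⟩ <;>
    · rintro rfl
      apply hC
      rw [Matrix.det_fin_three]
      simp
      try ring
  have hc : C 2 ≠ 0 := (hdet (C 0) (C 1) (C 2) 0 0 0 (by
    ext i j; fin_cases i <;> simp)).2.2
  set c := C 2 with hc'
  let k := star c ⬝ᵥ C 1 / (star c ⬝ᵥ c)
  let b := C 1 - k • c
  have hb : b ≠ 0 := (hdet (C 0) b c 0 0 k (by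
    ext i j; fin_cases i <;> simp [b, hc'])).2.1
  let r := star c ⬝ᵥ C 0 / (star c ⬝ᵥ c)
  let s := star b ⬝ᵥ C 0 / (star b ⬝ᵥ b)
  let a := C 0 - s • b - r • c
  have hC' : C = Matrix.of ![a + s • b + r • c, b + k • c, c] := by
    ext i j; fin_cases i <;> simp [a, b, hc']; ring
  have hcb : star c ⬝ᵥ b = 0 := by
    have := star_dotProduct_self_ne_zero hc
    simp only [b, k, dotProduct_sub, dotProduct_smul, smul_eq_mul]
    field_simp
    ring
  have hbc := star_dotProduct_comm_eq_zero hcb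
  refine ⟨a, b, c, s, r, k, ⟨star_dotProduct_comm_eq_zero ?_, hbc, ?_, (hdet a b c s r k hC').1, hb,
    hc⟩, hC'⟩
  · have := star_dotProduct_self_ne_zero hb
    simp only [a, s, dotProduct_sub, dotProduct_smul, hbc, smul_eq_mul, mul_zero, sub_zero]
    field_simp
    ring
  · have := star_dotProduct_self_ne_zero hc
    simp only [a, r, dotProduct_sub, dotProduct_smul, hcb, smul_eq_mul, mul_zero, sub_zero]
    field_simp
    ring

/-- `SU(3)` is Zariski dense for the polynomials that are homogeneous of the same degree in each of
the columns of a matrix. -/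
theorem eq_zero_of_triEval_cols {q : ℕ} {x : HilbSpace q}
    (hx : ∀ g : SU3, triEval (cols g) (triIncl q q q x) = 0) : x = 0 := by
  apply triIncl_injective
  rw [map_zero]
  refine eq_zero_of_triEval fun c => ?_
  have hinv : ∀ C : Matrix (Fin 3) (Fin 3) ℂ, C.det ≠ 0 → triEval C (triIncl q q q x) = 0 := by
    intro C hC
    obtain ⟨a, b, c, s, r, k, h, rfl⟩ := exists_isFrame hC
    exact triEval_triangular_eq_zero hx h s r k
  -- The matrices `c + t` are invertible for all but finitely many `t`.
  let M : Matrix (Fin 3) (Fin 3) ℂ := c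
  let P : Polynomial ℂ := triEval (fun k i => Polynomial.C (c k i) +
    Polynomial.X * Polynomial.C ((1 : Matrix (Fin 3) (Fin 3) ℂ) k i)) (triIncl q q q x)
  have hP : ∀ t : ℂ, P.eval t = triEval (M + t • (1 : Matrix (Fin 3) (Fin 3) ℂ))
      (triIncl q q q x) := by
    intro t
    rw [← Polynomial.coe_aeval_eq_eval, algHom_comp_triEval]
    congr 2
    funext k i
    change _ = c k i + t * (1 : Matrix (Fin 3) (Fin 3) ℂ) k i
    rw [map_add, map_mul, Polynomial.aeval_C, Polynomial.aeval_X, Polynomial.aeval_C]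
    rfl
  have hmul : P * (-M).charpoly = 0 := by
    apply Polynomial.funext
    intro t
    rw [Polynomial.eval_mul, Polynomial.eval_zero, Matrix.eval_charpoly, hP]
    by_cases hd : (M + t • (1 : Matrix (Fin 3) (Fin 3) ℂ)).det = 0
    · have : Matrix.scalar (Fin 3) t - -M = M + t • (1 : Matrix (Fin 3) (Fin 3) ℂ) := by
        rw [sub_neg_eq_add, add_comm, Matrix.scalar_apply, Matrix.smul_one_eq_diagonal]
      rw [this, hd, mul_zero]
    · rw [hinv _ hd, zero_mul]
  have hP0 : P = 0 := (mul_eq_zero.mp hmul).resolve_right (Matrix.charpoly_monic _).ne_zero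
  have := hP 0
  rw [hP0, Polynomial.eval_zero, zero_smul, add_zero] at this
  exact this.symm

/-! ### Intertwiners to `Hilb(p)` -/

/-- The polarization of a polynomial `f`: the coefficient of `a ^ α` in `f (∑ k, a k • Y k)`, for
three vectors `Y k` with entries in the algebra `TriPoly`. -/
def polar (Y : Fin 3 → Fin 3 → TriPoly) (α : Fin 3 →₀ ℕ) :
    MvPolynomial (Fin 3) ℂ →ₗ[ℂ] TriPoly :=
  (MvPolynomial.lcoeff TriPoly α).restrictScalars ℂ ∘ₗ
    (MvPolynomial.aeval fun i => ∑ k, Y k i • (MvPolynomial.X k : MvPolynomial (Fin 3) TriPoly) :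
      MvPolynomial (Fin 3) ℂ →ₐ[ℂ] MvPolynomial (Fin 3) TriPoly).toLinearMap

theorem polar_apply (Y : Fin 3 → Fin 3 → TriPoly) (α : Fin 3 →₀ ℕ) (f : MvPolynomial (Fin 3) ℂ) :
    polar Y α f = MvPolynomial.coeff α (MvPolynomial.aeval
      (fun i => ∑ k, Y k i • (MvPolynomial.X k : MvPolynomial (Fin 3) TriPoly)) f) := rfl

theorem polar_linSubst {Y : Fin 3 → Fin 3 → TriPoly} {A B : Matrix (Fin 3) (Fin 3) ℂ}
    (hY : ∀ k j, triAct B (Y k j) = ∑ i, A i j • Y k i) (α : Fin 3 →₀ ℕ)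
    (f : MvPolynomial (Fin 3) ℂ) :
    polar Y α (linSubst A f) = triAct B (polar Y α f) := by
  rw [polar_apply, polar_apply, aeval_linSubst]
  change _ = (triAct B).toRingHom _
  rw [← MvPolynomial.coeff_map]
  congr 1
  change _ = (MvPolynomial.mapAlgHom (triAct B)) _
  rw [← AlgHom.comp_apply]
  congr 1
  apply MvPolynomial.algHom_ext
  intro j
  simp only [MvPolynomial.aeval_X, AlgHom.comp_apply, map_sum, MvPolynomial.smul_eq_C_mul, map_mul,
    MvPolynomial.mapAlgHom_apply, MvPolynomial.map_C, MvPolynomial.map_X, RingHom.coe_coe, hY,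
    Finset.smul_sum]
  rw [Finset.sum_comm]
  refine Finset.sum_congr rfl fun k _ => ?_
  rw [Finset.sum_mul]
  refine Finset.sum_congr rfl fun i _ => ?_
  rw [← smul_mul_assoc]
  congr 1
  rw [Algebra.smul_def, Algebra.smul_def, map_mul]
  rfl

theorem polar_X_pow (Y : Fin 3 → Fin 3 → TriPoly) {n : ℕ} {α : Fin 3 →₀ ℕ} (hα : α ∈ exps n)
    (i : Fin 3) :
    polar Y α (MvPolynomial.X i ^ n) = mult α • monom α fun k => Y k i := by
  have h : α.sum (fun _ k => k) = n := by
    rw [← mem_exps_iff_degree.mp hα]; rfl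
  rw [polar_apply, map_pow, MvPolynomial.aeval_X,
    MvPolynomial.coeff_linearCombination_X_pow_of_fintype, if_pos h, mult, monom,
    Finsupp.prod_fintype _ _ (by simp), Nat.cast_smul_eq_nsmul ℂ, nsmul_eq_mul]

/-- The coordinate `i` of the cross product of the vectors `k + 1` and `k + 2`, indices being taken
modulo `3`; i.e. the cofactors of the matrix of the three vectors. -/
def triCof (k i : Fin 3) : TriPoly :=
  triVar (k + 1) (i + 1) * triVar (k + 2) (i + 2) - triVar (k + 1) (i + 2) * triVar (k + 2) (i + 1)

theorem triAct_triCof (g : SU3) (k j : Fin 3) :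
    triAct (fund g) (triCof k j) = ∑ i, extSquare g i j • triCof k i := by
  have hext : ∀ i j : Fin 3, extSquare g i j = fund g (i + 1) (j + 1) * fund g (i + 2) (j + 2) -
      fund g (i + 1) (j + 2) * fund g (i + 2) (j + 1) := by
    intro i j
    change g.1.adjugate j i = g.1 _ _ * g.1 _ _ - g.1 _ _ * g.1 _ _
    rw [Matrix.adjugate_fin_three]
    fin_cases i <;> fin_cases j <;> simp <;> ring
  simp only [triCof, map_sub, map_mul, triAct_triVar, hext]
  generalize triVar (k + 1) = v
  generalize triVar (k + 2) = w
  simp only [Fin.sum_univ_three, Algebra.smul_def, map_sub, map_mul, zero_add, Fin.reduceAdd]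
  ring

/-- The equivariant map from `Sym^n(ℂ³) ⊗ Sym^m(Λ²ℂ³)` to the polynomials in three vectors given by
polarization along the three vectors and along their cross products. -/
def polarMap (n m : ℕ) (α β : Fin 3 →₀ ℕ) : HPoly n ⊗[ℂ] HPoly m →ₗ[ℂ] TriPoly :=
  LinearMap.mul' ℂ TriPoly ∘ₗ TensorProduct.map (polar triVar α ∘ₗ (HPoly n).subtype)
    (polar triCof β ∘ₗ (HPoly m).subtype)

theorem polarMap_tmul {n m : ℕ} (α β : Fin 3 →₀ ℕ) (f : HPoly n) (h : HPoly m) :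
    polarMap n m α β (f ⊗ₜ h) = polar triVar α f.1 * polar triCof β h.1 := by
  simp [polarMap]

theorem polarMap_ambient {n m : ℕ} (α β : Fin 3 →₀ ℕ) (g : SU3) (w : HPoly n ⊗[ℂ] HPoly m) :
    polarMap n m α β (ambient n m g w) = triAct (fund g) (polarMap n m α β w) := by
  induction w with
  | zero => simp
  | add x y hx hy => simp only [map_add, hx, hy]
  | tmul f h =>
    rw [Representation.tprod_apply, TensorProduct.map_tmul, polarMap_tmul, polarMap_tmul, map_mul]
    exact congrArg₂ _ (polar_linSubst (triAct_triVar _) α f.1)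
      (polar_linSubst (triAct_triCof g) β h.1)

/-- The projection on the homogeneous part of degree `q`. -/
def homProj (q : ℕ) : MvPolynomial (Fin 3) ℂ →ₗ[ℂ] HPoly q :=
  (MvPolynomial.homogeneousComponent q).codRestrict _
    fun f => MvPolynomial.homogeneousComponent_isHomogeneous q f

theorem homProj_linSubst (q : ℕ) (A : Matrix (Fin 3) (Fin 3) ℂ) (f : MvPolynomial (Fin 3) ℂ) :
    (homProj q (linSubst A f)).1 = linSubst A (homProj q f).1 := by
  change MvPolynomial.homogeneousComponent q (linSubst A f) =
    linSubst A (MvPolynomial.homogeneousComponent q f)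
  have key : ∀ k : ℕ, MvPolynomial.homogeneousComponent q
      (linSubst A (MvPolynomial.homogeneousComponent k f)) =
        if k = q then linSubst A (MvPolynomial.homogeneousComponent q f) else 0 := fun k => by
    rw [MvPolynomial.homogeneousComponent_of_mem (linSubst_mem A k
      (MvPolynomial.homogeneousComponent_isHomogeneous k f))]
    by_cases h : k = q
    · subst h; simp
    · simp [h, Ne.symm h]
  conv_lhs => rw [← MvPolynomial.sum_homogeneousComponent f]
  rw [map_sum, map_sum, Finset.sum_congr rfl fun k _ => key k, Finset.sum_ite_eq']
  split_ifs with h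
  · rfl
  · rw [MvPolynomial.homogeneousComponent_eq_zero, map_zero]
    rw [Finset.mem_range] at h
    omega

/-- The projection on the part of degree `q` in each of the three vectors. -/
def triProj (q : ℕ) : TriPoly →ₗ[ℂ] HilbSpace q :=
  TensorProduct.map (homProj q) (TensorProduct.map (homProj q) (homProj q)) ∘ₗ
    triEquiv.symm.toLinearMap

theorem triProj_triTmul (q : ℕ) (f g h : MvPolynomial (Fin 3) ℂ) :
    triProj q (triTmul f g h) = homProj q f ⊗ₜ (homProj q g ⊗ₜ homProj q h) := rfl

theorem triProj_triIncl (q : ℕ) (x : HilbSpace q) : triProj q (triIncl q q q x) = x := by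
  have h : ∀ f : HPoly q, homProj q f.1 = f := fun f => Subtype.ext (by
    change MvPolynomial.homogeneousComponent q f.1 = f.1
    rw [MvPolynomial.homogeneousComponent_of_mem f.2, if_pos rfl])
  induction x using triIncl_induction with
  | zero => simp
  | add x y hx hy => rw [map_add, map_add, hx, hy]
  | tmul f g k => rw [triIncl_tmul, triProj_triTmul, h, h, h]

theorem triProj_triAct (q : ℕ) (g : SU3) (x : TriPoly) :
    triProj q (triAct (fund g) x) = Hilb q g (triProj q x) := by
  have h : ∀ f, homProj q (linSubst (fund g) f) = Sym q g (homProj q f) := fun f =>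
    Subtype.ext (homProj_linSubst q (fund g) f)
  induction x using triPoly_induction with
  | zero => simp
  | add x y hx hy => simp only [map_add, hx, hy]
  | tmul f₁ f₂ f₃ =>
    rw [triAct_triTmul, triProj_triTmul, h, h, h, triProj_triTmul]
    rfl

/-- The intertwiner to `Hilb(q)` given by polarization. -/
def polarIntertwiner (n m q : ℕ) (α β : Fin 3 →₀ ℕ) :
    Representation.IntertwiningMap (irrep n m) (Hilb q) where
  toLinearMap := triProj q ∘ₗ polarMap n m α β ∘ₗ (irrepSub n m).toSubmodule.subtype
  isIntertwining' g := by
    ext w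
    change triProj q (polarMap n m α β (ambient n m g w.1)) =
      Hilb q g (triProj q (polarMap n m α β w.1))
    rw [polarMap_ambient, triProj_triAct]

/-! ### Multidegrees -/

theorem mul_mem_range_triIncl {a b c a' b' c' : ℕ} {x y : TriPoly}
    (hx : x ∈ LinearMap.range (triIncl a b c)) (hy : y ∈ LinearMap.range (triIncl a' b' c')) :
    x * y ∈ LinearMap.range (triIncl (a + a') (b + b') (c + c')) := by
  obtain ⟨x, rfl⟩ := hx
  obtain ⟨y, rfl⟩ := hy
  induction x using triIncl_induction with
  | zero => simp
  | add x₁ x₂ h₁ h₂ => rw [map_add, add_mul]; exact add_mem h₁ h₂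
  | tmul f g h =>
    induction y using triIncl_induction with
    | zero => simp
    | add y₁ y₂ h₁ h₂ => rw [map_add, mul_add]; exact add_mem h₁ h₂
    | tmul f' g' h' =>
      exact ⟨⟨_, f.2.mul f'.2⟩ ⊗ₜ (⟨_, g.2.mul g'.2⟩ ⊗ₜ ⟨_, h.2.mul h'.2⟩),
        (triTmul_mul _ _ _ _ _ _).symm⟩

theorem pow_mem_range_triIncl {a b c : ℕ} {x : TriPoly} (hx : x ∈ LinearMap.range (triIncl a b c))
    (k : ℕ) : x ^ k ∈ LinearMap.range (triIncl (k * a) (k * b) (k * c)) := by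
  induction k with
  | zero =>
    rw [pow_zero, zero_mul, zero_mul, zero_mul]
    have h1 := MvPolynomial.isHomogeneous_one (Fin 3) ℂ
    exact ⟨⟨1, h1⟩ ⊗ₜ (⟨1, h1⟩ ⊗ₜ ⟨1, h1⟩), rfl⟩
  | succ k ih =>
    rw [pow_succ, add_mul, add_mul, add_mul, one_mul, one_mul, one_mul]
    exact mul_mem_range_triIncl ih hx

theorem triVar_mem_range_triIncl (k i : Fin 3) : triVar k i ∈ LinearMap.range
    (triIncl (if k = 0 then 1 else 0) (if k = 1 then 1 else 0) (if k = 2 then 1 else 0)) := by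
  have h1 := MvPolynomial.isHomogeneous_one (Fin 3) ℂ
  have hX := MvPolynomial.isHomogeneous_X ℂ i
  fin_cases k
  · exact ⟨⟨_, hX⟩ ⊗ₜ (⟨1, h1⟩ ⊗ₜ ⟨1, h1⟩), rfl⟩
  · exact ⟨⟨1, h1⟩ ⊗ₜ (⟨_, hX⟩ ⊗ₜ ⟨1, h1⟩), rfl⟩
  · exact ⟨⟨1, h1⟩ ⊗ₜ (⟨1, h1⟩ ⊗ₜ ⟨_, hX⟩), rfl⟩

theorem triCof_mem_range_triIncl (k i : Fin 3) : triCof k i ∈ LinearMap.range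
    (triIncl (if k = 0 then 0 else 1) (if k = 1 then 0 else 1) (if k = 2 then 0 else 1)) := by
  have h := fun i j => mul_mem_range_triIncl (triVar_mem_range_triIncl (k + 1) i)
    (triVar_mem_range_triIncl (k + 2) j)
  have := sub_mem (h (i + 1) (i + 2)) (h (i + 2) (i + 1))
  fin_cases k <;> exact this

theorem monom_mem_range_triIncl {q : ℕ} {α β : Fin 3 →₀ ℕ} (h0 : α 0 + β 1 + β 2 = q)
    (h1 : α 1 + β 0 + β 2 = q) (h2 : α 2 + β 0 + β 1 = q) (i j : Fin 3) :
    monom α (fun k => triVar k i) * monom β (fun k => triCof k j) ∈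
      LinearMap.range (triIncl q q q) := by
  have hV := fun k => pow_mem_range_triIncl (triVar_mem_range_triIncl k i) (α k)
  have hC := fun k => pow_mem_range_triIncl (triCof_mem_range_triIncl k j) (β k)
  have := mul_mem_range_triIncl (mul_mem_range_triIncl (mul_mem_range_triIncl (hV 0) (hV 1)) (hV 2))
    (mul_mem_range_triIncl (mul_mem_range_triIncl (hC 0) (hC 1)) (hC 2))
  have hcast : ∀ {a b c : ℕ} {x : TriPoly}, a = q → b = q → c = q →
      x ∈ LinearMap.range (triIncl a b c) → x ∈ LinearMap.range (triIncl q q q) := by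
    rintro a b c x rfl rfl rfl h
    exact h
  rw [monom, monom, Fin.prod_univ_three, Fin.prod_univ_three]
  exact hcast (by simp; omega) (by simp; omega) (by simp; omega) this

theorem triIncl_polarIntertwiner_hwVector {n m q : ℕ} {α β : Fin 3 →₀ ℕ} (hα : α ∈ exps n)
    (hβ : β ∈ exps m) (h0 : α 0 + β 1 + β 2 = q) (h1 : α 1 + β 0 + β 2 = q)
    (h2 : α 2 + β 0 + β 1 = q) :
    triIncl q q q (polarIntertwiner n m q α β (hwVector n m)) =
      (mult α * mult β) • (monom α (fun k => triVar k 0) * monom β (fun k => triCof k 2)) := by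
  obtain ⟨y, hy⟩ := monom_mem_range_triIncl h0 h1 h2 0 2
  have h : polarMap n m α β (highestWeightVector n m) = triIncl q q q ((mult α * mult β) • y) := by
    rw [map_smul, hy, highestWeightVector, polarMap_tmul]
    change polar triVar α (MvPolynomial.X 0 ^ n) * polar triCof β (MvPolynomial.X 2 ^ m) = _
    rw [polar_X_pow _ hα, polar_X_pow _ hβ, smul_mul_smul_comm]
  change triIncl q q q (triProj q (polarMap n m α β (highestWeightVector n m))) = _
  rw [h, triProj_triIncl, map_smul, hy]

/-- The polarizations whose exponents range over the same `M + 1` pairs as the coefficients that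
determine an element of weight zero are linearly independent. -/
theorem le_rank_intertwiner_Hilb {n m q M c₁ c₂ : ℕ} (hn : n = M + 3 * c₁) (hm : m = M + 3 * c₂)
    (hq : q = M + c₁ + 2 * c₂) :
    ((M + 1 : ℕ) : Cardinal) ≤
      Module.rank ℂ (Representation.IntertwiningMap (irrep n m) (Hilb q)) := by
  let a : Fin (M + 1) → Fin 3 →₀ ℕ := fun j => expo (j + c₁) (M - j + c₁) c₁
  let b : Fin (M + 1) → Fin 3 →₀ ℕ := fun j => expo (j + c₂) (M - j + c₂) c₂
  have hli : LinearIndependent ℂ fun j => polarIntertwiner n m q (a j) (b j) := by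
    -- The three vectors `(1, s + 1, 0)`, `(1, 0, 0)`, `(1, s, 0)` have first coordinates `1` and
    -- their cross products have last coordinates `s`, `1`, `-1 - s`.
    let E : Representation.IntertwiningMap (irrep n m) (Hilb q) →ₗ[ℂ] (ℂ → ℂ) :=
      { toFun := fun φ s => triEval ![![1, s + 1, 0], ![1, 0, 0], ![1, s, 0]]
          (triIncl q q q (φ.toLinearMap (hwVector n m)))
        map_add' := fun φ ψ => by ext s; simp
        map_smul' := fun c φ => by ext s; simp }
    refine LinearIndependent.of_comp E ?_
    rw [Fintype.linearIndependent_iff]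
    intro g hg
    have hev : ∀ s : ℂ, (∑ j : Fin (M + 1), (g j * (mult (a j) * mult (b j))) * s ^ (j : ℕ)) *
        (s ^ c₂ * (-1 - s) ^ c₂) = 0 := by
      intro s
      have h1 := congrFun hg s
      rw [Finset.sum_apply, Pi.zero_apply] at h1
      rw [← h1, Finset.sum_mul]
      refine Finset.sum_congr rfl fun j _ => ?_
      have hj := j.2
      change _ = g j * triEval _ (triIncl q q q (polarIntertwiner n m q (a j) (b j) (hwVector n m)))
      rw [triIncl_polarIntertwiner_hwVector (by rw [mem_exps]; simp [a]; omega)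
        (by rw [mem_exps]; simp [b]; omega) (by simp [a, b]; omega) (by simp [a, b]; omega)
        (by simp [a, b]; omega)]
      simp only [map_smul, map_mul, monom, map_pow, triCof, map_sub, triEval_triVar,
        Fin.prod_univ_three, a, b, expo_zero, expo_one, expo_two, smul_eq_mul]
      simp
      ring
    have hP : (∑ j : Fin (M + 1), Polynomial.C (g j * (mult (a j) * mult (b j))) *
        Polynomial.X ^ (j : ℕ)) = 0 := by
      have hmul : (∑ j : Fin (M + 1), Polynomial.C (g j * (mult (a j) * mult (b j))) *
          Polynomial.X ^ (j : ℕ)) * (Polynomial.X ^ c₂ * (-1 - Polynomial.X) ^ c₂) = 0 := by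
        apply Polynomial.funext
        intro s
        rw [Polynomial.eval_zero, ← hev s]
        simp [Polynomial.eval_finsetSum]
      refine (mul_eq_zero.mp hmul).resolve_right (mul_ne_zero (pow_ne_zero _ Polynomial.X_ne_zero)
        (pow_ne_zero _ fun h => ?_))
      have := congrArg (Polynomial.eval 0) h
      simp at this
    intro j
    have := congrArg (fun P => Polynomial.coeff P (j : ℕ)) hP
    simp only [Polynomial.finsetSum_coeff, Polynomial.coeff_C_mul_X_pow, Polynomial.coeff_zero]
      at this
    rw [Finset.sum_eq_single j (fun i _ hi => if_neg fun h => hi (Fin.ext h.symm)) (by simp),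
      if_pos rfl] at this
    exact (mul_eq_zero.mp this).resolve_right (mul_ne_zero (mult_ne_zero _) (mult_ne_zero _))
  simpa using hli.cardinal_le_rank

/-! ### From `Hilb(q)` to torus invariant functionals -/

/-- The transpose of an element of `SU(3)`. The group acts on polynomials in a matrix through its
transpose, so that evaluation at `g` is evaluation at `1` after acting by the transpose of `g`. -/
def transposeSU (g : SU3) : SU3 :=
  ⟨g.1.transpose, by
    have h := Matrix.mem_specialUnitaryGroup_iff.mp g.2
    rw [Matrix.mem_specialUnitaryGroup_iff, Matrix.mem_unitaryGroup_iff, Matrix.det_transpose]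
    refine ⟨?_, h.2⟩
    have h2 := congrArg Matrix.transpose (Matrix.mem_unitaryGroup_iff'.mp h.1)
    rwa [Matrix.transpose_mul, Matrix.transpose_one] at h2⟩

theorem triEval_cols_one (g : SU3) (x : TriPoly) :
    triEval (cols 1) (triAct (fund (transposeSU g)) x) = triEval (cols g) x := by
  rw [triEval_triAct]
  congr 2
  funext k j
  simp only [cols, map_one]
  rw [Finset.sum_eq_single k (fun i _ hi => by rw [Matrix.one_apply_ne hi, smul_zero]) (by simp),
    Matrix.one_apply_eq, smul_eq_mul, mul_one]
  rfl

/-- Evaluation of an intertwiner to `Hilb(q)`, seen as a polynomial in a matrix, at the identity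
matrix. The result is torus invariant as a diagonal matrix of determinant one multiplies the value
by a power of its determinant. -/
def evalOne (n m q : ℕ) :
    Representation.IntertwiningMap (irrep n m) (Hilb q) →ₗ[ℂ] torusInvariants n m where
  toFun φ := ⟨(triEval (cols 1)).toLinearMap ∘ₗ triIncl q q q ∘ₗ φ.toLinearMap, by
    intro t ht w
    have h1 : φ.toLinearMap (irrep n m t w) = Hilb q t (φ.toLinearMap w) :=
      LinearMap.congr_fun (φ.isIntertwining' t) w
    have h2 : (fun k j => ∑ i, fund t i j • cols 1 k i) =
        fun k j => fund t k k * cols 1 k j := by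
      funext k j
      simp only [cols, map_one]
      rw [Finset.sum_eq_single k (fun i _ hi => by rw [Matrix.one_apply_ne hi, smul_zero])
        (by simp), Matrix.one_apply_eq, smul_eq_mul, mul_one]
      by_cases hkj : k = j
      · subst hkj; simp
      · rw [Matrix.one_apply_ne (Ne.symm hkj), mul_zero]
        exact ht hkj
    have h3 : fund t 0 0 * fund t 1 1 * fund t 2 2 = 1 := by
      have hdet := (Matrix.mem_specialUnitaryGroup_iff.mp t.2).2
      have hd : Matrix.diagonal (fun i => t.1 i i) = t.1 := Matrix.IsDiag.diagonal_diag ht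
      rw [← hd, Matrix.det_diagonal, Fin.prod_univ_three] at hdet
      exact hdet
    simp only [LinearMap.comp_apply, AlgHom.toLinearMap_apply]
    rw [h1, triIncl_Hilb, triEval_triAct, h2,
      triEval_smul _ (fun k => fund t k k) (cols 1), h3, one_pow, one_mul]⟩
  map_add' _ _ := Subtype.ext (LinearMap.ext fun w => by
    simp)
  map_smul' _ _ := Subtype.ext (LinearMap.ext fun w => by
    simp)

theorem evalOne_injective (n m q : ℕ) : Function.Injective (evalOne n m q) := by
  intro φ ψ h
  apply Representation.IntertwiningMap.ext
  ext1 w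
  rw [← sub_eq_zero]
  refine eq_zero_of_triEval_cols fun g => ?_
  have h1 : ∀ φ : Representation.IntertwiningMap (irrep n m) (Hilb q),
      triEval (cols g) (triIncl q q q (φ.toLinearMap w)) =
        (evalOne n m q φ).1 (irrep n m (transposeSU g) w) := by
    intro φ
    have h2 : φ.toLinearMap (irrep n m (transposeSU g) w) =
        Hilb q (transposeSU g) (φ.toLinearMap w) :=
      LinearMap.congr_fun (φ.isIntertwining' _) w
    rw [← triEval_cols_one, ← triIncl_Hilb, ← h2]
    rfl
  rw [map_sub, map_sub, h1, h1, h, sub_self]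

/-! ### Continuity of matrix coefficients -/

theorem continuous_linSubst {τ : SU3 → Matrix (Fin 3) (Fin 3) ℂ}
    (hτ : ∀ i j, Continuous fun g => τ g i j) (f : MvPolynomial (Fin 3) ℂ)
    (l : MvPolynomial (Fin 3) ℂ →ₗ[ℂ] ℂ) : Continuous fun g => l (linSubst (τ g) f) := by
  induction f using MvPolynomial.induction_on generalizing l with
  | C a =>
    have : ∀ g, linSubst (τ g) (MvPolynomial.C a) = MvPolynomial.C a := fun g =>
      (linSubst (τ g)).commutes a
    simp only [this]
    exact continuous_const
  | add p q hp hq =>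
    simp only [map_add]
    exact (hp l).add (hq l)
  | mul_X p j hp =>
    have : ∀ g, l (linSubst (τ g) (p * MvPolynomial.X j)) =
        ∑ i, τ g i j * (l ∘ₗ LinearMap.mulRight ℂ (MvPolynomial.X i)) (linSubst (τ g) p) := by
      intro g
      rw [map_mul]
      simp only [linSubst, MvPolynomial.aeval_X, Finset.mul_sum, map_sum,
        ← MvPolynomial.smul_eq_C_mul, mul_smul_comm, map_smul, smul_eq_mul, LinearMap.comp_apply,
        LinearMap.mulRight_apply]
    simp only [this]
    exact continuous_finsetSum _ fun i _ => (hτ i j).mul (hp _)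

theorem continuous_linSubst₂ {τ τ' : SU3 → Matrix (Fin 3) (Fin 3) ℂ}
    (hτ : ∀ i j, Continuous fun g => τ g i j) (hτ' : ∀ i j, Continuous fun g => τ' g i j)
    (f h : MvPolynomial (Fin 3) ℂ)
    (B : MvPolynomial (Fin 3) ℂ →ₗ[ℂ] MvPolynomial (Fin 3) ℂ →ₗ[ℂ] ℂ) :
    Continuous fun g => B (linSubst (τ g) f) (linSubst (τ' g) h) := by
  induction f using MvPolynomial.induction_on generalizing B with
  | C a =>
    have : ∀ g, linSubst (τ g) (MvPolynomial.C a) = MvPolynomial.C a := fun g =>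
      (linSubst (τ g)).commutes a
    simp only [this]
    exact continuous_linSubst hτ' h _
  | add p q hp hq =>
    simp only [map_add, LinearMap.add_apply]
    exact (hp B).add (hq B)
  | mul_X p j hp =>
    have : ∀ g, B (linSubst (τ g) (p * MvPolynomial.X j)) (linSubst (τ' g) h) =
        ∑ i, τ g i j * (B ∘ₗ LinearMap.mulRight ℂ (MvPolynomial.X i)) (linSubst (τ g) p)
          (linSubst (τ' g) h) := by
      intro g
      rw [map_mul]
      have hX : linSubst (τ g) (MvPolynomial.X j) = ∑ i, τ g i j • MvPolynomial.X i := by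
        simp [linSubst, MvPolynomial.smul_eq_C_mul]
      rw [hX, Finset.mul_sum, map_sum, LinearMap.sum_apply]
      refine Finset.sum_congr rfl fun i _ => ?_
      rw [mul_smul_comm, map_smul]
      rfl
    simp only [this]
    exact continuous_finsetSum _ fun i _ => (hτ i j).mul (hp _)

theorem continuous_fund (i j : Fin 3) : Continuous fun g : SU3 => fund g i j :=
  continuous_subtype_val.matrix_elem i j

/-- The functional extends to all pairs of polynomials, where matrix coefficients are polynomials in
the entries of `g` and their conjugates. -/
theorem continuous_matrixCoeff {n m : ℕ} (l : Module.Dual ℂ (irrepSub n m).toSubmodule)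
    (w : (irrepSub n m).toSubmodule) : Continuous fun g => l (irrep n m g w) := by
  let ι : HPoly n ⊗[ℂ] HPoly m →ₗ[ℂ] MvPolynomial (Fin 3) ℂ ⊗[ℂ] MvPolynomial (Fin 3) ℂ :=
    TensorProduct.map (HPoly n).subtype (HPoly m).subtype
  have hι : Function.Injective ι :=
    TensorProduct.map_injective_of_flat_flat _ _ Subtype.val_injective Subtype.val_injective
  obtain ⟨r, hr⟩ := LinearMap.exists_leftInverse_of_injective
    (ι ∘ₗ (irrepSub n m).toSubmodule.subtype)
    (LinearMap.ker_eq_bot.mpr (hι.comp Subtype.val_injective))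
  have hl : ∀ v, l v = (l ∘ₗ r) (ι v.1) := fun v => by
    have := LinearMap.congr_fun hr v
    exact congrArg l this.symm
  simp only [hl]
  have key : ∀ (k : MvPolynomial (Fin 3) ℂ ⊗[ℂ] MvPolynomial (Fin 3) ℂ →ₗ[ℂ] ℂ)
      (x : HPoly n ⊗[ℂ] HPoly m), Continuous fun g => k (ι (ambient n m g x)) := by
    intro k x
    induction x with
    | zero => simpa using continuous_const
    | add x y hx hy =>
      simp only [map_add]
      exact hx.add hy
    | tmul f h =>
      exact continuous_linSubst₂ continuous_fund
        (fun i j => by simpa only [extSquare_eq] using (continuous_fund i j).star) f.1 h.1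
        (TensorProduct.curry k)
  exact key _ w.1

/-! ### Square integrable functions on the flag manifold -/

instance : SecondCountableTopology SU3 :=
  have : SecondCountableTopology (Matrix (Fin 3) (Fin 3) ℂ) :=
    inferInstanceAs (SecondCountableTopology (Fin 3 → Fin 3 → ℂ))
  inferInstanceAs (SecondCountableTopology
    (Matrix.specialUnitaryGroup (Fin 3) ℂ : Set (Matrix (Fin 3) (Fin 3) ℂ)))

instance : IsFiniteMeasure flagMeasure := by
  unfold flagMeasure
  infer_instance

/-- The Haar measure of `SU(3)`. -/
abbrev haarSU : Measure SU3 :=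
  Measure.haarMeasure (⊤ : TopologicalSpace.PositiveCompacts SU3)

/-- The function `k T ↦ l (k⁻¹ w)` on the flag manifold. -/
def flagFun {n m : ℕ} (l : torusInvariants n m) (w : (irrepSub n m).toSubmodule) : F3 → ℂ :=
  Quotient.lift (fun k : SU3 => l.1 (irrep n m k⁻¹ w)) fun k k' h => by
    have ht : k⁻¹ * k' ∈ torus := QuotientGroup.leftRel_apply.mp h
    have h1 : irrep n m k⁻¹ w = irrep n m (k⁻¹ * k') (irrep n m k'⁻¹ w) := by
      rw [← Module.End.mul_apply, ← map_mul, mul_assoc, mul_inv_cancel, mul_one]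
    simp only [h1]
    exact l.2 _ ht _

theorem flagFun_mk {n m : ℕ} (l : torusInvariants n m) (w : (irrepSub n m).toSubmodule) (k : SU3) :
    flagFun l w (QuotientGroup.mk k) = l.1 (irrep n m k⁻¹ w) := rfl

theorem measurable_flagFun {n m : ℕ} (l : torusInvariants n m) (w : (irrepSub n m).toSubmodule) :
    Measurable (flagFun l w) := by
  rw [QuotientGroup.measurable_from_quotient]
  exact ((continuous_matrixCoeff l.1 w).comp continuous_inv).measurable

theorem memLp_flagFun {n m : ℕ} (l : torusInvariants n m) (w : (irrepSub n m).toSubmodule) :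
    MemLp (flagFun l w) 2 flagMeasure := by
  obtain ⟨C, hC⟩ := isCompact_univ.exists_bound_of_continuousOn
    (continuous_matrixCoeff l.1 w).continuousOn
  refine MemLp.of_bound (measurable_flagFun l w).aestronglyMeasurable C (ae_of_all _ fun x => ?_)
  obtain ⟨k, rfl⟩ := QuotientGroup.mk_surjective x
  exact hC k⁻¹ trivial

/-- The intertwiner to `L²(F(3))` given by a torus invariant functional. -/
def toL2 (n m : ℕ) :
    torusInvariants n m →ₗ[ℂ] Representation.IntertwiningMap (irrep n m) L2F3 where
  toFun l :=
    { toFun := fun w => (memLp_flagFun l w).toLp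
      map_add' := fun v w => by
        rw [← MemLp.toLp_add]
        congr 1
        funext x
        obtain ⟨k, rfl⟩ := QuotientGroup.mk_surjective x
        simp [flagFun_mk]
      map_smul' := fun c w => by
        rw [RingHom.id_apply, ← MemLp.toLp_const_smul]
        congr 1
        funext x
        obtain ⟨k, rfl⟩ := QuotientGroup.mk_surjective x
        simp [flagFun_mk]
      isIntertwining' := fun g => by
        ext1 w
        change (memLp_flagFun l (irrep n m g w)).toLp =
          DomMulAct.mk g⁻¹ • (memLp_flagFun l w).toLp
        rw [DomMulAct.mk_smul_toLp]
        congr 1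
        funext x
        obtain ⟨k, rfl⟩ := QuotientGroup.mk_surjective x
        change l.1 (irrep n m k⁻¹ (irrep n m g w)) = l.1 (irrep n m (g⁻¹ * k)⁻¹ w)
        rw [mul_inv_rev, inv_inv, map_mul, Module.End.mul_apply] }
  map_add' k l := by
    apply Representation.IntertwiningMap.ext
    ext1 w
    change (memLp_flagFun (k + l) w).toLp = (memLp_flagFun k w).toLp + (memLp_flagFun l w).toLp
    rw [← MemLp.toLp_add]
    congr 1
    funext x
    obtain ⟨k, rfl⟩ := QuotientGroup.mk_surjective x
    simp [flagFun_mk]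
  map_smul' c l := by
    apply Representation.IntertwiningMap.ext
    ext1 w
    change (memLp_flagFun (c • l) w).toLp = c • (memLp_flagFun l w).toLp
    rw [← MemLp.toLp_const_smul]
    congr 1
    funext x
    obtain ⟨k, rfl⟩ := QuotientGroup.mk_surjective x
    simp [flagFun_mk]

theorem toL2_injective (n m : ℕ) : Function.Injective (toL2 n m) := by
  intro k l hkl
  refine Subtype.ext (LinearMap.ext fun w => ?_)
  have h1 : (memLp_flagFun k w).toLp = (memLp_flagFun l w).toLp :=
    LinearMap.congr_fun (congrArg Representation.IntertwiningMap.toLinearMap hkl) w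
  have h2 : flagFun k w =ᵐ[flagMeasure] flagFun l w := (MemLp.toLp_eq_toLp_iff _ _).mp h1
  have h3 : (fun g : SU3 => k.1 (irrep n m g⁻¹ w)) =ᵐ[haarSU] fun g => l.1 (irrep n m g⁻¹ w) :=
    ae_of_ae_map QuotientGroup.measurable_coe.aemeasurable h2
  have h4 := (Continuous.ae_eq_iff_eq haarSU
    ((continuous_matrixCoeff k.1 w).comp continuous_inv)
    ((continuous_matrixCoeff l.1 w).comp continuous_inv)).mp h3
  simpa using congrFun h4 1

/-- By Fubini, an equivariance that holds almost everywhere for each group element holds at almost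
every point for almost all group elements; so a function satisfying it is almost everywhere a matrix
coefficient. -/
theorem exists_ae_eq_of_ae_equivariant {ι : Type} [Fintype ι] {F : ι → SU3 → ℂ}
    (hF : ∀ i, Measurable (F i)) {c : SU3 → ι → ι → ℂ} (hc : ∀ i j, Continuous fun h => c h i j)
    (h : ∀ g, ∀ᵐ k ∂haarSU, ∀ i, F i (g * k) = ∑ j, c g i j * F j k) :
    ∃ k, ∀ᵐ g ∂haarSU, ∀ i, F i g = ∑ j, c (g * k⁻¹) i j * F j k := by
  have hmeas : MeasurableSet {x : SU3 × SU3 | ∀ i, F i (x.1 * x.2) = ∑ j, c x.1 i j * F j x.2} := by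
    rw [Set.ofPred_forall]
    refine MeasurableSet.iInter fun i => measurableSet_eq_fun ((hF i).comp measurable_mul) ?_
    exact Finset.measurable_sum _ fun j _ =>
      ((hc i j).measurable.comp measurable_fst).mul ((hF j).comp measurable_snd)
  obtain ⟨k, hk⟩ := ((Measure.ae_ae_comm hmeas).mp (ae_of_all haarSU h)).exists
  refine ⟨k, ?_⟩
  filter_upwards [(quasiMeasurePreserving_mul_right haarSU k⁻¹).ae hk] with g hg i
  rw [← hg i, inv_mul_cancel_right]

/-- A functional whose matrix coefficients are almost everywhere invariant under the torus is
invariant under the torus. -/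
theorem mem_torusInvariants_of_ae {n m : ℕ} {l : Module.Dual ℂ (irrepSub n m).toSubmodule}
    {F : (irrepSub n m).toSubmodule → F3 → ℂ}
    (h : ∀ w, ∀ᵐ g ∂haarSU, F w (QuotientGroup.mk g) = l (irrep n m g⁻¹ w)) :
    l ∈ torusInvariants n m := by
  intro t ht w
  have h1 := (quasiMeasurePreserving_mul_right haarSU t⁻¹).ae (h w)
  have h2 : (fun g : SU3 => l (irrep n m (g * t⁻¹)⁻¹ w)) =ᵐ[haarSU]
      fun g => l (irrep n m g⁻¹ w) := by
    filter_upwards [h1, h w] with g h1 h2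
    rw [← h1, ← h2, QuotientGroup.mk_mul_of_mem _ (torus.inv_mem ht)]
  have h3 := (Continuous.ae_eq_iff_eq haarSU ((continuous_matrixCoeff l w).comp
    (continuous_inv.comp (continuous_mul_const t⁻¹)))
    ((continuous_matrixCoeff l w).comp continuous_inv)).mp h2
  simpa using congrFun h3 1

/-- Every intertwiner to `L²(F(3))` is given by a torus invariant functional, namely by evaluation
at a generic point. -/
theorem toL2_surjective (n m : ℕ) : Function.Surjective (toL2 n m) := by
  intro φ
  let e := Module.finBasis ℂ (irrepSub n m).toSubmodule
  let Φ : (irrepSub n m).toSubmodule →ₗ[ℂ] Lp ℂ 2 flagMeasure := φ.toLinearMap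
  let f : (irrepSub n m).toSubmodule → F3 → ℂ := fun w => Φ w
  have hf : ∀ w, Measurable (f w) := fun w => (Lp.stronglyMeasurable _).measurable
  have hequi : ∀ g : SU3, ∀ᵐ k ∂haarSU, ∀ i, f (e i) (QuotientGroup.mk (g * k)) =
      ∑ j, e.coord j (irrep n m g⁻¹ (e i)) * f (e j) (QuotientGroup.mk k) := by
    intro g
    rw [ae_all_iff]
    intro i
    have h1 : Φ (irrep n m g⁻¹ (e i)) = DomMulAct.mk g • Φ (e i) := by
      refine (LinearMap.congr_fun (φ.isIntertwining' g⁻¹) (e i)).trans ?_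
      change DomMulAct.mk (g⁻¹)⁻¹ • Φ (e i) = _
      rw [inv_inv]
    have h2 : Φ (irrep n m g⁻¹ (e i)) = ∑ j, e.coord j (irrep n m g⁻¹ (e i)) • Φ (e j) := by
      conv_lhs => rw [← e.sum_repr (irrep n m g⁻¹ (e i))]
      rw [map_sum]
      exact Finset.sum_congr rfl fun j _ => map_smul _ _ _
    refine ae_of_ae_map (p := fun x => f (e i) (g • x) =
      ∑ j, e.coord j (irrep n m g⁻¹ (e i)) * f (e j) x)
      QuotientGroup.measurable_coe.aemeasurable ?_
    have h4 := DomMulAct.smul_Lp_ae_eq (DomMulAct.mk g) (Φ (e i))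
    rw [← h1, h2] at h4
    have h5 := Lp.coeFn_finsetSum Finset.univ
      fun j => e.coord j (irrep n m g⁻¹ (e i)) • Φ (e j)
    have h6 := ae_all_iff.mpr fun j => Lp.coeFn_smul (e.coord j (irrep n m g⁻¹ (e i))) (Φ (e j))
    filter_upwards [h4, h5, h6] with x h4 h5 h6
    rw [h5] at h4
    refine h4.symm.trans ?_
    rw [Finset.sum_apply]
    exact Finset.sum_congr rfl fun j _ => h6 j
  obtain ⟨k, hk⟩ := exists_ae_eq_of_ae_equivariant
    (F := fun i g => f (e i) (QuotientGroup.mk g))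
    (c := fun g i j => e.coord j (irrep n m g⁻¹ (e i)))
    (fun i => (hf _).comp QuotientGroup.measurable_coe)
    (fun i j => (continuous_matrixCoeff (e.coord j) (e i)).comp continuous_inv) hequi
  let l₀ : Module.Dual ℂ (irrepSub n m).toSubmodule :=
    ∑ j, f (e j) (QuotientGroup.mk k) • e.coord j
  let l : Module.Dual ℂ (irrepSub n m).toSubmodule := l₀ ∘ₗ irrep n m k
  have hl : ∀ i, ∀ᵐ g ∂haarSU, f (e i) (QuotientGroup.mk g) = l (irrep n m g⁻¹ (e i)) := by
    intro i
    filter_upwards [hk] with g hg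
    refine (hg i).trans ?_
    have h1 : irrep n m (g * k⁻¹)⁻¹ (e i) = irrep n m k (irrep n m g⁻¹ (e i)) := by
      rw [mul_inv_rev, inv_inv, map_mul, Module.End.mul_apply]
    simp only [h1, l, l₀, LinearMap.comp_apply, LinearMap.sum_apply, LinearMap.smul_apply,
      smul_eq_mul]
    exact Finset.sum_congr rfl fun j _ => mul_comm _ _
  have hl' : ∀ w, ∀ᵐ g ∂haarSU, (∑ i, e.coord i w * f (e i) (QuotientGroup.mk g)) =
      l (irrep n m g⁻¹ w) := by
    intro w
    filter_upwards [ae_all_iff.mpr hl] with g hg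
    conv_rhs => rw [← e.sum_repr w]
    simp only [hg, map_sum, map_smul, smul_eq_mul]
    rfl
  have hinv : l ∈ torusInvariants n m :=
    mem_torusInvariants_of_ae (F := fun w x => ∑ i, e.coord i w * f (e i) x) hl'
  refine ⟨⟨l, hinv⟩, ?_⟩
  apply Representation.IntertwiningMap.ext
  refine e.ext fun i => ?_
  change (memLp_flagFun ⟨l, hinv⟩ (e i)).toLp = Φ (e i)
  refine Lp.ext ((MemLp.coeFn_toLp _).trans ?_)
  refine (ae_map_iff QuotientGroup.measurable_coe.aemeasurable
    (measurableSet_eq_fun (measurable_flagFun _ _) (hf (e i)))).mpr ?_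
  filter_upwards [hl i] with g hg
  exact hg.symm

end FlagThree

end

theorem mainTheorem3 (n m p : ℕ) (h : n + 2 * m = 3 * (p + 1)) :
    (FlagThree.irrep n m).IsIrreducible ∧
      FlagThree.multiplicity (FlagThree.irrep n m) (FlagThree.Hilb p) = 0 ∧
      FlagThree.multiplicity (FlagThree.irrep n m) (FlagThree.Hilb (p + 1)) =
        ((min m n + 1 : ℕ) : Cardinal) ∧
      FlagThree.multiplicity (FlagThree.irrep n m) FlagThree.L2F3 =
        ((min m n + 1 : ℕ) : Cardinal) := by
  -- `n - m` is divisible by `3`, since `n + 2 * m` is.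
  obtain ⟨c₁, c₂, hn, hm, hc⟩ : ∃ c₁ c₂, n = min m n + 3 * c₁ ∧ m = min m n + 3 * c₂ ∧
      (c₁ = 0 ∨ c₂ = 0) := ⟨(n - m) / 3, (m - n) / 3, by omega, by omega, by omega⟩
  have hle := FlagThree.rank_torusInvariants_le hn hm hc
  have hge := FlagThree.le_rank_intertwiner_Hilb hn hm (q := p + 1) (by omega)
  have hmid := LinearMap.rank_le_of_injective _ (FlagThree.evalOne_injective n m (p + 1))
  have hL2 := (LinearEquiv.ofBijective _
    ⟨FlagThree.toL2_injective n m, FlagThree.toL2_surjective n m⟩).rank_eq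
  refine ⟨FlagThree.irrep_isIrreducible n m, ?_, le_antisymm (hmid.trans hle) hge, ?_⟩
  · have : Subsingleton (Representation.IntertwiningMap (FlagThree.irrep n m) (FlagThree.Hilb p)) :=
      ⟨fun φ ψ => by
        rw [FlagThree.intertwiner_Hilb_eq_zero h φ, FlagThree.intertwiner_Hilb_eq_zero h ψ]⟩
    exact rank_subsingleton' _ _
  · exact hL2.symm.trans (le_antisymm hle (hge.trans hmid))
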